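/- Let $\mathcal H\subset\mathbb R^2$ be open with $B_2(0)\subset\mathcal H\subset B_{\mathcal R}(0)$ for some $\mathcal R\in(2,\infty)$. Let $J\in C^2(\mathbb R^2)$ be radially symmetric, with $J>0$ for $|x|<d$, $J=0$ for $|x|\ge d$, and $\int_{\mathbb R^2}J=1$, and put $Lg:=J*g-g$. Let $u_0$ satisfy $(H_0)$: $u_0\ge0$, $u_0=0$ in $\mathcal H$, $u_0\in L^\infty(\mathbb R^2)\cap L^1(\mathbb R^2,\log|x|\,dx)$; $(H_1)$: $u_0\in L^1(\mathbb R^2,|x|^2\,dx)$. There is a unique function $\phi$ with $L\phi=0$ in $\mathbb R^2\setminus\mathcal H$, $\phi=0$ in $\mathcal H$ and $\phi(x)-\log|x|\in L^\infty(\mathbb R^2\setminus\mathcal H)$, and there is a unique solution $u\in C([0,\infty);L^1(\mathbb R^2))$ of $$\partial_tu=Lu\ \text{ in }(\mathbb R^2\setminus\mathcal H)\times(0,\infty),\qquad u=0\ \text{ in }\mathcal H\times(0,\infty),\qquad u(\cdot,0)=u_0\ \text{ in }\mathbb R^2$$ (with $\partial_t u$ the derivative of the curve $t\mapsto u(\cdot,t)$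 in $L^1(\mathbb R^2)$). The function $u_0\phi$ is integrable and, with $M_\phi^*:=\int_{\mathbb R^2}u_0\phi\,dx$, $$\log t\int_{\mathbb R^2}u(x,t)\,dx\longrightarrow 2M_\phi^*\qquad\text{as }t\to\infty.$$ -/

import Mathlib

open MeasureTheory Filter Topology

open scoped Convolution

/-- The Euclidean plane. -/
abbrev Plane : Type := EuclideanSpace ℝ (Fin 2)

/-- The hypothesis on the hole: `H` is open and `B_2(0) ⊂ H ⊂ B_R(0)` for some `R ∈ (2, ∞)`. -/
structure IsHole (H : Set Plane) : Prop where
  isOpen : IsOpen H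
  ball_two_subset : Metric.ball (0 : Plane) 2 ⊆ H
  subset_ball : ∃ R : ℝ, 2 < R ∧ H ⊆ Metric.ball (0 : Plane) R

/-- The hypothesis on the kernel: `J` is of class `C²`, radially symmetric, positive on the
ball of radius `d`, zero outside this ball, and has unit integral. -/
structure IsDispersalKernel (d : ℝ) (J : Plane → ℝ) : Prop where
  contDiff : ContDiff ℝ 2 J
  radial : ∀ x y : Plane, ‖x‖ = ‖y‖ → J x = J y
  pos : ∀ x : Plane, ‖x‖ < d → 0 < J x
  eq_zero : ∀ x : Plane, d ≤ ‖x‖ → J x = 0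
  integral_eq_one : ∫ x, J x = 1

/-- The nonlocal operator `L g = J * g - g`. -/
noncomputable def nonlocalOp (J g : Plane → ℝ) (x : Plane) : ℝ :=
  (J ⋆[ContinuousLinearMap.lsmul ℝ ℝ, volume] g) x - g x

/-- `φ` is a stationary solution (`L φ = 0` outside the hole, `φ = 0` in the hole) with
logarithmic behaviour at infinity, `φ - log |x| ∈ L^∞(ℝ² \ H)`. -/
structure IsLogStationary (J : Plane → ℝ) (H : Set Plane) (φ : Plane → ℝ) : Prop where
  stationary : ∀ x, x ∉ H → nonlocalOp J φ x = 0
  eq_zero : ∀ x ∈ H, φ x = 0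
  log_behavior : MemLp (fun x => φ x - Real.log ‖x‖) ⊤ (volume.restrict Hᶜ)

/-- `u ∈ C([0, ∞); L¹(ℝ²))` solves `∂ₜ u = L u` in `(ℝ² \ H) × (0, ∞)`, `u = 0` in
`H × (0, ∞)`, `u(·, 0) = u₀`. The time derivative is that of an `L¹`-valued curve. Values of
`u` at negative times are irrelevant. -/
structure IsDirichletSolution (J : Plane → ℝ) (H : Set Plane) (u₀ : Plane → ℝ)
    (u : ℝ → Lp ℝ 1 (volume : Measure Plane)) : Prop where
  continuousOn : ContinuousOn u (Set.Ici 0)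
  equation : ∀ t : ℝ, 0 < t → ∃ w : Lp ℝ 1 (volume : Measure Plane), HasDerivAt u w t ∧
    ∀ᵐ x : Plane, x ∉ H → w x = nonlocalOp J (u t) x
  dirichlet : ∀ t : ℝ, 0 < t → ∀ᵐ x : Plane, x ∈ H → u t x = 0
  initial : ∀ᵐ x : Plane, u 0 x = u₀ x

/-- The hypotheses on the initial datum: `u₀ ≥ 0`, `u₀ = 0` in `H`,
`u₀ ∈ L^∞(ℝ²) ∩ L¹(ℝ², log |x| dx)` and `u₀ ∈ L¹(ℝ², |x|² dx)`. -/
structure IsAdmissibleDatum (H : Set Plane) (u₀ : Plane → ℝ) : Prop where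
  nonneg : ∀ᵐ x : Plane, 0 ≤ u₀ x
  eq_zero : ∀ᵐ x : Plane, x ∈ H → u₀ x = 0
  bounded : MemLp u₀ ⊤ volume
  log_moment : Integrable (fun x : Plane => u₀ x * Real.log ‖x‖) volume
  second_moment : Integrable (fun x : Plane => u₀ x * ‖x‖ ^ 2) volume

/-! The equation is a killed random walk in continuous time. Let `T` be the map `f ↦ 1_{ℝ² \ H} (J *
f)` on `L¹`. The solution is `exp (t (T - 1)) u₀`, a Poisson mixture of the functions `T ^ n u₀`.
Since `J` is even, `T` can be moved onto a test function. As `φ` vanishes in the hole and `J * φ =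
φ` outside it, `∫ u φ = M` is conserved (`lintegral_exp_mul_stationary`). At the diffusive scale
`|x| ~ √t` the weight `φ` is close to `(log t) / 2`, so the mass must behave like `2 M / log t`. Two
estimates make this rigorous.

For the upper bound, `φ ≥ log r - C` outside the ball of radius `r = √t / (2 log³ t)`, while the
mass inside is `O(1 / log² t)` (`exists_setIntegral_ball_le`). The latter compares the killed walk
with the free one, tested against a Fejér kernel in one coordinate; no heat kernel asymptotics are
needed. For the lower bound, `log |x| ≤ (log s) / 2 + |x|² / s` with `s = t log t`, and the second
moment grows at most linearly in `t` (`integral_exp_mul_normSq_le`). Both errors disappear in the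
limit (`tendsto_log_mul_of_bounds`).

The function `φ` is the truncated logarithm plus a bounded correction. By the mean value property
(`kernelAvg_log`) the truncated logarithm fails to be stationary only on a bounded set, and a
Neumann series removes the defect. The series converges because a subsolution that is nonpositive on
`B_2` falls below its upper bound by a definite factor on every ball (`exists_improved_bound`). The
same contraction gives the maximum principle, hence positivity and uniqueness of `φ`. -/

/-! ### Elementary properties of the averaging operator. -/

/-- The weighted average `J * g` of `g`, written with the kernel centred at the evaluation point. -/
noncomputable def kernelAvg (J g : Plane → ℝ) (x : Plane) : ℝ := ∫ y, J (x - y) * g y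

lemma nonlocalOp_eq (J g : Plane → ℝ) (x : Plane) :
    nonlocalOp J g x = kernelAvg J g x - g x := by
  simp only [nonlocalOp, kernelAvg, convolution_lsmul_swap, smul_eq_mul]

lemma kernelAvg_eq_convolution (J g : Plane → ℝ) :
    kernelAvg J g = J ⋆[ContinuousLinearMap.lsmul ℝ ℝ, volume] g := by
  funext x
  simp only [kernelAvg, convolution_lsmul_swap, smul_eq_mul]

lemma kernelAvg_congr_ae (J : Plane → ℝ) {g h : Plane → ℝ} (e : g =ᵐ[volume] h) (x : Plane) :
    kernelAvg J g x = kernelAvg J h x := by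
  apply integral_congr_ae
  filter_upwards [e] with y hy
  rw [hy]

lemma kernelAvg_eq_integral_sub (J g : Plane → ℝ) (x : Plane) :
    kernelAvg J g x = ∫ t, J t * g (x - t) := by
  rw [kernelAvg_eq_convolution, convolution_lsmul]
  simp only [smul_eq_mul]

namespace IsDispersalKernel

variable {d : ℝ} {J : Plane → ℝ}

lemma d_pos (hJ : IsDispersalKernel d J) : 0 < d := by
  by_contra! hd
  have h : J = fun _ => 0 := funext fun x => hJ.eq_zero x (hd.trans (norm_nonneg x))
  have := hJ.integral_eq_one
  rw [h] at this
  simp at this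

lemma nonneg (hJ : IsDispersalKernel d J) (x : Plane) : 0 ≤ J x := by
  rcases lt_or_ge ‖x‖ d with h | h
  · exact (hJ.pos x h).le
  · exact (hJ.eq_zero x h).ge

lemma continuous (hJ : IsDispersalKernel d J) : Continuous J := hJ.contDiff.continuous

lemma hasCompactSupport (hJ : IsDispersalKernel d J) : HasCompactSupport J := by
  apply HasCompactSupport.intro (isCompact_closedBall (0 : Plane) d)
  intro x hx
  apply hJ.eq_zero
  simp only [Metric.mem_closedBall, dist_zero_right, not_le] at hx
  exact hx.le

lemma integrable (hJ : IsDispersalKernel d J) : Integrable J :=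
  hJ.continuous.integrable_of_hasCompactSupport hJ.hasCompactSupport

lemma neg (hJ : IsDispersalKernel d J) (x : Plane) : J (-x) = J x :=
  hJ.radial _ _ (norm_neg x)

lemma sub_comm (hJ : IsDispersalKernel d J) (x y : Plane) : J (x - y) = J (y - x) :=
  hJ.radial _ _ (norm_sub_rev x y)

lemma integrable_mul (hJ : IsDispersalKernel d J) {g : Plane → ℝ} (hg : LocallyIntegrable g)
    (x : Plane) : Integrable fun y => J (x - y) * g y := by
  have h := hJ.hasCompactSupport.convolutionExists_left (ContinuousLinearMap.lsmul ℝ ℝ)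
    hJ.continuous hg x
  have := h.integrable_swap
  simpa using this

lemma integrable_mul_sub (hJ : IsDispersalKernel d J) {g : Plane → ℝ} (hg : LocallyIntegrable g)
    (x : Plane) : Integrable fun t => J t * g (x - t) := by
  have h := hJ.hasCompactSupport.convolutionExists_left (ContinuousLinearMap.lsmul ℝ ℝ)
    hJ.continuous hg x
  simpa using h.integrable

lemma continuous_kernelAvg (hJ : IsDispersalKernel d J) {g : Plane → ℝ}
    (hg : LocallyIntegrable g) : Continuous (kernelAvg J g) := by
  rw [kernelAvg_eq_convolution]
  exact hJ.hasCompactSupport.continuous_convolution_left _ hJ.continuous hg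

lemma integral_sub_left (hJ : IsDispersalKernel d J) (x : Plane) : ∫ y, J (x - y) = 1 := by
  rw [integral_sub_left_eq_self J volume x, hJ.integral_eq_one]

lemma kernelAvg_const (hJ : IsDispersalKernel d J) (c : ℝ) (x : Plane) :
    kernelAvg J (fun _ => c) x = c := by
  simp only [kernelAvg, integral_mul_const, hJ.integral_sub_left, one_mul]

lemma kernelAvg_mono (hJ : IsDispersalKernel d J) {g h : Plane → ℝ} (hg : LocallyIntegrable g)
    (hh : LocallyIntegrable h) (hle : ∀ᵐ y, g y ≤ h y) (x : Plane) :
    kernelAvg J g x ≤ kernelAvg J h x := by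
  apply integral_mono_ae (hJ.integrable_mul hg x) (hJ.integrable_mul hh x)
  filter_upwards [hle] with y hy
  exact mul_le_mul_of_nonneg_left hy (hJ.nonneg _)

lemma kernelAvg_nonneg (hJ : IsDispersalKernel d J) {g : Plane → ℝ} (hg : ∀ᵐ y, 0 ≤ g y)
    (x : Plane) : 0 ≤ kernelAvg J g x := by
  apply integral_nonneg_of_ae
  filter_upwards [hg] with y hy
  exact mul_nonneg (hJ.nonneg _) hy

lemma kernelAvg_add (hJ : IsDispersalKernel d J) {g h : Plane → ℝ} (hg : LocallyIntegrable g)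
    (hh : LocallyIntegrable h) (x : Plane) :
    kernelAvg J (fun y => g y + h y) x = kernelAvg J g x + kernelAvg J h x := by
  simp only [kernelAvg, mul_add]
  exact integral_add (hJ.integrable_mul hg x) (hJ.integrable_mul hh x)

lemma kernelAvg_sub (hJ : IsDispersalKernel d J) {g h : Plane → ℝ} (hg : LocallyIntegrable g)
    (hh : LocallyIntegrable h) (x : Plane) :
    kernelAvg J (fun y => g y - h y) x = kernelAvg J g x - kernelAvg J h x := by
  simp only [kernelAvg, mul_sub]
  exact integral_sub (hJ.integrable_mul hg x) (hJ.integrable_mul hh x)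

end IsDispersalKernel

lemma kernelAvg_const_mul (J : Plane → ℝ) (c : ℝ) (g : Plane → ℝ) (x : Plane) :
    kernelAvg J (fun y => c * g y) x = c * kernelAvg J g x := by
  simp only [kernelAvg, mul_left_comm _ c, integral_const_mul]

namespace IsDispersalKernel

variable {d : ℝ} {J : Plane → ℝ}

lemma kernelAvg_congr (hJ : IsDispersalKernel d J) {g h : Plane → ℝ} {x : Plane}
    (e : ∀ y, ‖x - y‖ < d → g y = h y) : kernelAvg J g x = kernelAvg J h x := by
  apply integral_congr_ae
  filter_upwards with y
  rcases lt_or_ge ‖x - y‖ d with hy | hy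
  · rw [e y hy]
  · simp only [hJ.eq_zero _ hy, zero_mul]

end IsDispersalKernel

/-! ### Propagation of smallness and the maximum principle. -/

/-- A bounded a.e. strongly measurable function is locally integrable. -/
lemma locallyIntegrable_of_bound {g : Plane → ℝ} (hg : AEStronglyMeasurable g) (C : ℝ)
    (hC : ∀ᵐ x, |g x| ≤ C) : LocallyIntegrable g := by
  have : MemLp g ⊤ volume := memLp_top_of_bound hg C hC
  exact this.locallyIntegrable le_top

namespace IsDispersalKernel

variable {d : ℝ} {J : Plane → ℝ}

/-- The mass that the kernel centred at `x` puts on a ball is bounded below for `x` in a slightly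
larger ball. -/
lemma exists_mass_ball_lower_bound (hJ : IsDispersalKernel d J) {ρ : ℝ} (hρ : 1 ≤ ρ) :
    ∃ c > 0, ∀ x : Plane, ‖x‖ ≤ ρ + min d 1 / 2 →
      c ≤ kernelAvg J ((Metric.ball (0 : Plane) ρ).indicator fun _ => 1) x := by
  have hd := hJ.d_pos
  set η := min d 1 / 2 with hη
  have hη0 : 0 < η := by positivity
  have hηd : η ≤ d / 2 := by have := min_le_left d 1; linarith
  have hη1 : η ≤ 1 / 2 := by have := min_le_right d 1; linarith
  have hloc : LocallyIntegrable ((Metric.ball (0 : Plane) ρ).indicator fun _ => (1 : ℝ)) := by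
    refine locallyIntegrable_of_bound ?_ 1 ?_
    · exact (measurable_const.indicator Metric.isOpen_ball.measurableSet).aestronglyMeasurable
    · filter_upwards with x
      by_cases h : x ∈ Metric.ball (0 : Plane) ρ <;> simp [h]
  have hcont := hJ.continuous_kernelAvg hloc
  obtain ⟨x₀, hx₀, hmin⟩ := (isCompact_closedBall (0 : Plane) (ρ + η)).exists_isMinOn
    ⟨0, by simp; linarith⟩ hcont.continuousOn
  refine ⟨_, ?_, fun x hx => hmin (show x ∈ Metric.closedBall (0 : Plane) (ρ + η) by simpa using hx)⟩
  have hx₀' : ‖x₀‖ ≤ ρ + η := by simpa using hx₀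
  rw [gt_iff_lt, kernelAvg, integral_pos_iff_support_of_nonneg]
  · set U : Set Plane := Metric.ball 0 ρ ∩ Metric.ball x₀ d
    have hU : IsOpen U := Metric.isOpen_ball.inter Metric.isOpen_ball
    have hne : U.Nonempty := by
      -- Pulling `x₀` towards the origin by the factor `1 - θ` moves it by at most `3η/2 < d` and
      -- leaves norm at most `ρ - η/2`, so the new point lies in both balls.
      set θ := (3 * η / 2) / (ρ + η) with hθ
      have hpos : 0 < ρ + η := by linarith
      have hθ0 : 0 ≤ θ := by positivity
      have hθ1 : θ ≤ 1 := by rw [hθ, div_le_one hpos]; linarith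
      have hθm : θ * (ρ + η) = 3 * η / 2 := by rw [hθ]; field_simp
      refine ⟨(1 - θ) • x₀, ?_, ?_⟩
      · simp only [Metric.mem_ball, dist_zero_right, norm_smul, Real.norm_eq_abs]
        rw [abs_of_nonneg (by linarith)]
        nlinarith
      · have : (1 - θ) • x₀ - x₀ = (-θ) • x₀ := by rw [sub_smul, one_smul, neg_smul]; abel
        rw [Metric.mem_ball, dist_eq_norm, this, norm_smul, norm_neg, Real.norm_eq_abs,
          abs_of_nonneg hθ0]
        nlinarith
    refine (hU.measure_pos volume hne).trans_le (measure_mono ?_)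
    rintro y ⟨hy1, hy2⟩
    rw [Function.mem_support, Set.indicator_of_mem hy1, mul_one]
    apply ne_of_gt
    apply hJ.pos
    rwa [Metric.mem_ball, dist_comm, dist_eq_norm] at hy2
  · intro y
    exact mul_nonneg (hJ.nonneg _) (Set.indicator_nonneg (fun _ _ => zero_le_one) _)
  · exact hJ.integrable_mul hloc x₀

/-- A function that is nonpositive on `B_2` and `L`-subharmonic up to an error `a` elsewhere on a
ball is, on this ball, smaller than its upper bound `S` by a definite factor. -/
lemma exists_improved_bound (hJ : IsDispersalKernel d J) (ρ : ℝ) :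
    ∃ C ≥ 0, ∃ δ > 0, δ ≤ 1 ∧ ∀ (G : Plane → ℝ) (S a : ℝ), LocallyIntegrable G → 0 ≤ S → 0 ≤ a →
      (∀ᵐ x, G x ≤ S) → (∀ᵐ x, ‖x‖ < 2 → G x ≤ 0) →
      (∀ᵐ x, 2 ≤ ‖x‖ → ‖x‖ < ρ → G x ≤ 0 ∨ G x ≤ a + kernelAvg J G x) →
      ∀ᵐ x, ‖x‖ < ρ → G x ≤ C * a + (1 - δ) * S := by
  have hd := hJ.d_pos
  set η := min d 1 / 2 with hη
  have hη0 : 0 < η := by positivity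
  -- The gain travels outwards from `B_2` in steps of length `η`: at each step the kernel still puts
  -- mass at least `c` on the ball already treated.
  have key : ∀ n : ℕ, ∃ C ≥ 0, ∃ δ > 0, δ ≤ 1 ∧ ∀ (G : Plane → ℝ) (S a : ℝ),
      LocallyIntegrable G → 0 ≤ S → 0 ≤ a →
      (∀ᵐ x, G x ≤ S) → (∀ᵐ x, ‖x‖ < 2 → G x ≤ 0) →
      (∀ᵐ x, 2 ≤ ‖x‖ → ‖x‖ < ρ → G x ≤ 0 ∨ G x ≤ a + kernelAvg J G x) →
      ∀ᵐ x, ‖x‖ < min ρ (2 + n * η) → G x ≤ C * a + (1 - δ) * S := by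
    intro n
    induction n with
    | zero =>
      refine ⟨0, le_rfl, 1, one_pos, le_rfl, fun G S a _ _ _ _ h2 _ => ?_⟩
      filter_upwards [h2] with x hx hx'
      have := hx (by simpa using hx'.trans_le (min_le_right _ _))
      linarith
    | succ n ih =>
      obtain ⟨C, hC, δ, hδ, hδ1, ih⟩ := ih
      -- The radius is raised to at least `1`, as the mass bound requires; for `ρ < 1` the
      -- inclusions are not needed.
      obtain ⟨r, hr1, hrρ, hr⟩ : ∃ r : ℝ, 1 ≤ r ∧ (1 ≤ ρ → r ≤ min ρ (2 + n * η)) ∧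
          (1 ≤ ρ → min ρ (2 + (n + 1 : ℕ) * η) ≤ r + η) := by
        refine ⟨max 1 (min ρ (2 + n * η)), le_max_left _ _, fun h => ?_, fun h => ?_⟩
        · refine max_le (le_min h ?_) le_rfl
          have : 0 ≤ (n : ℝ) * η := by positivity
          linarith
        · have := le_max_right 1 (min ρ (2 + n * η))
          have e : 2 + ((n + 1 : ℕ) : ℝ) * η = 2 + n * η + η := by push_cast; ring
          rw [e]
          refine le_trans ?_ (add_le_add_left this η)
          rcases le_total ρ (2 + n * η) with h1 | h1
          · rw [min_eq_left h1]; exact (min_le_left _ _).trans (by linarith)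
          · rw [min_eq_right h1]; exact min_le_right _ _
      obtain ⟨c, hc, hmass⟩ := hJ.exists_mass_ball_lower_bound hr1
      -- Averaging `G ≤ S + C a - δ S 1_{B_r}` gives `a + J * G ≤ (C + 1) a + (1 - δ c) S`. The
      -- minimum keeps the new `δ` at most `1`.
      refine ⟨C + 1, by linarith, min 1 (δ * c), by positivity, min_le_left _ _, ?_⟩
      intro G S a hG hS ha h1 h2 h3
      have h4 := ih G S a hG hS ha h1 h2 h3
      have hδ' : min 1 (δ * c) ≤ δ * c := min_le_right _ _
      have hδ'' : min 1 (δ * c) ≤ 1 := min_le_left _ _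
      filter_upwards [h2, h3] with x hx2 hx3 hx
      have hnonneg : 0 ≤ (C + 1) * a + (1 - min 1 (δ * c)) * S := by
        have : 0 ≤ (1 - min 1 (δ * c)) * S := mul_nonneg (by linarith) hS
        positivity
      rcases lt_or_ge ‖x‖ 2 with hx' | hx'
      · exact (hx2 hx').trans hnonneg
      have hρ2 : 2 < ρ := hx'.trans_lt (hx.trans_le (min_le_left _ _))
      have hρ1 : 1 ≤ ρ := by linarith
      rcases hx3 hx' (hx.trans_le (min_le_left _ _)) with hx3' | hx3'
      · exact hx3'.trans hnonneg
      refine hx3'.trans ?_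
      set I : Plane → ℝ := (Metric.ball (0 : Plane) r).indicator fun _ => 1 with hI
      have hloc : LocallyIntegrable I := by
        refine locallyIntegrable_of_bound ?_ 1 ?_
        · exact (measurable_const.indicator Metric.isOpen_ball.measurableSet).aestronglyMeasurable
        · filter_upwards with x
          by_cases h : x ∈ Metric.ball (0 : Plane) r <;> simp [hI, h]
      have hconst : LocallyIntegrable (fun _ : Plane => S + C * a) := locallyIntegrable_const _
      have hloc' : LocallyIntegrable (fun y => δ * S * I y) := hloc.smul (δ * S)
      have hle : kernelAvg J G x ≤ kernelAvg J (fun y => (S + C * a) - δ * S * I y) x := by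
        apply hJ.kernelAvg_mono hG (hconst.sub hloc')
        filter_upwards [h1, h4] with y hy1 hy4
        by_cases hy : y ∈ Metric.ball (0 : Plane) r
        · have := hy4 ((by simpa using hy : ‖y‖ < r).trans_le (hrρ hρ1))
          simp only [Pi.sub_apply, hI, Set.indicator_of_mem hy]
          linarith
        · simp only [Pi.sub_apply, hI, Set.indicator_of_notMem hy]
          have : 0 ≤ C * a := by positivity
          linarith
      rw [hJ.kernelAvg_sub hconst hloc', hJ.kernelAvg_const, kernelAvg_const_mul] at hle
      have hm := hmass x ((hx.le.trans (hr hρ1)))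
      have : δ * S * c ≤ δ * S * kernelAvg J I x :=
        mul_le_mul_of_nonneg_left hm (by positivity)
      have : S * min 1 (δ * c) ≤ S * (δ * c) := mul_le_mul_of_nonneg_left hδ' hS
      linarith
  obtain ⟨n, hn⟩ := exists_nat_gt ((ρ - 2) / η)
  obtain ⟨C, hC, δ, hδ, hδ1, h⟩ := key n
  rw [div_lt_iff₀ hη0] at hn
  rw [min_eq_left (by linarith)] at h
  exact ⟨C, hC, δ, hδ, hδ1, h⟩

/-- Maximum principle for functions that are bounded above and nonpositive near infinity. -/
lemma nonpos_of_le_kernelAvg (hJ : IsDispersalKernel d J) {G : Plane → ℝ} {S ρ : ℝ}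
    (hG : LocallyIntegrable G) (hS : ∀ᵐ x, G x ≤ S) (h2 : ∀ᵐ x, ‖x‖ < 2 → G x ≤ 0)
    (hρ : ∀ᵐ x, ρ ≤ ‖x‖ → G x ≤ 0)
    (hle : ∀ᵐ x, 2 ≤ ‖x‖ → ‖x‖ < ρ → G x ≤ 0 ∨ G x ≤ kernelAvg J G x) : ∀ᵐ x, G x ≤ 0 := by
  obtain ⟨C, hC, δ, hδ, hδ1, h⟩ := hJ.exists_improved_bound ρ
  have hS' : ∀ᵐ x, G x ≤ max S 0 := hS.mono fun x hx => hx.trans (le_max_left _ _)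
  -- With `a = 0`, and with `G ≤ 0` beyond `ρ`, the improved bound holds on the whole plane and can
  -- be fed back as the next `S`.
  have key : ∀ n : ℕ, ∀ᵐ x, G x ≤ (1 - δ) ^ n * max S 0 := by
    intro n
    have h0 : ∀ n : ℕ, 0 ≤ (1 - δ) ^ n * max S 0 := fun n =>
      mul_nonneg (pow_nonneg (by linarith) _) (le_max_right _ _)
    induction n with
    | zero => simpa using hS'
    | succ n ih =>
      have := h G _ 0 hG (h0 n) le_rfl ih h2 (by simpa using hle)
      filter_upwards [this, hρ] with x hx1 hx2
      rcases lt_or_ge ‖x‖ ρ with hx | hx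
      · refine (hx1 hx).trans (le_of_eq ?_)
        ring
      · exact (hx2 hx).trans (h0 _)
  rw [← ae_all_iff] at key
  filter_upwards [key] with x hx
  have hlim : Tendsto (fun n : ℕ => (1 - δ) ^ n * max S 0) atTop (𝓝 (0 * max S 0)) :=
    (tendsto_pow_atTop_nhds_zero_of_lt_one (by linarith) (by linarith)).mul_const _
  rw [zero_mul] at hlim
  exact ge_of_tendsto' hlim hx

end IsDispersalKernel

/-! ### Harmonicity of the logarithm for the averaging operator. -/

/-- A compactly supported function on `ℂ` whose averages over all circles centred at the origin
vanish has zero integral. -/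
lemma integral_eq_zero_of_circleAverage_eq_zero {f : ℂ → ℝ} {d : ℝ}
    (hc : ContinuousOn f (Metric.closedBall 0 d)) (h0 : ∀ z, d ≤ ‖z‖ → f z = 0)
    (havg : ∀ r, 0 < r → r < d → Real.circleAverage f 0 r = 0) : ∫ z, f z = 0 := by
  rw [← Complex.integral_comp_polarCoord_symm]
  have hcirc : ∀ p : ℝ × ℝ, Complex.polarCoord.symm p = circleMap 0 p.1 p.2 := by
    intro p
    rw [Complex.polarCoord_symm_apply, circleMap, zero_add, Complex.exp_mul_I,
      Complex.ofReal_cos, Complex.ofReal_sin]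
  have hnorm : ∀ p : ℝ × ℝ, ‖circleMap 0 p.1 p.2‖ = |p.1| := by simp
  have hcont : Continuous fun p : ℝ × ℝ => circleMap 0 p.1 p.2 := by
    unfold circleMap
    fun_prop
  simp only [hcirc, smul_eq_mul]
  have hint : IntegrableOn (fun p : ℝ × ℝ => p.1 * f (circleMap 0 p.1 p.2))
      (Set.Ioi 0 ×ˢ Set.Ioo (-Real.pi) Real.pi) := by
    have h1 : IntegrableOn (fun p : ℝ × ℝ => p.1 * f (circleMap 0 p.1 p.2))
        (Set.Icc 0 d ×ˢ Set.Icc (-Real.pi) Real.pi) := by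
      apply ContinuousOn.integrableOn_compact (isCompact_Icc.prod isCompact_Icc)
      apply continuous_fst.continuousOn.mul
      apply hc.comp hcont.continuousOn
      rintro p ⟨⟨hp1, hp2⟩, -⟩
      simp only [Metric.mem_closedBall, dist_zero_right, hnorm, abs_of_nonneg hp1, hp2]
    refine h1.of_forall_sdiff_eq_zero (measurableSet_Ioi.prod measurableSet_Ioo) ?_
    rintro p ⟨⟨hp1, hp2⟩, hp3⟩
    rw [h0, mul_zero]
    rw [hnorm]
    by_contra! h
    exact hp3 ⟨⟨le_of_lt hp1, (le_abs_self _).trans h.le⟩, hp2.1.le, hp2.2.le⟩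
  change ∫ p in Set.Ioi (0 : ℝ) ×ˢ Set.Ioo (-Real.pi) Real.pi, _ = _
  rw [Measure.volume_eq_prod] at hint ⊢
  rw [setIntegral_prod _ hint]
  apply setIntegral_eq_zero_of_forall_eq_zero
  intro r hr
  have hr0 : 0 < r := hr
  simp only [integral_const_mul]
  rcases lt_or_ge r d with hrd | hrd
  · have h := havg r hr0 hrd
    rw [Real.circleAverage_eq_integral_add (-Real.pi), intervalIntegral.integral_comp_add_right
      (fun θ ↦ f (circleMap 0 r θ)), zero_add, show 2 * Real.pi + -Real.pi = Real.pi by ring,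
      intervalIntegral.integral_of_le (by linarith [Real.pi_pos]), smul_eq_mul] at h
    rw [← integral_Ioc_eq_integral_Ioo]
    rcases mul_eq_zero.1 h with h | h
    · have := Real.pi_pos
      have : (2 * Real.pi)⁻¹ ≠ 0 := by positivity
      contradiction
    · rw [h, mul_zero]
  · rw [setIntegral_eq_zero_of_forall_eq_zero, mul_zero]
    intro θ _
    apply h0
    rw [hnorm (r, θ)]
    exact hrd.trans (le_abs_self _)

/-- The mean value property, as `z ↦ log ‖z - w‖` is harmonic in `‖z‖ < ‖w‖`. It is read off from
the general formula `log r + log⁺ (‖w‖ / r)`. -/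
lemma circleAverage_log_norm_sub_of_lt {w : ℂ} {r : ℝ} (hr : 0 < r) (hw : r < ‖w‖) :
    Real.circleAverage (fun z => Real.log ‖z - w‖) 0 r = Real.log ‖w‖ := by
  have := circleAverage_log_norm_sub_const_eq_log_radius_add_posLog (a := w) (c := 0) hr.ne'
  rw [this, zero_sub, norm_neg, Real.posLog_eq_log, Real.log_mul (inv_ne_zero hr.ne')
    (hr.trans hw).ne', Real.log_inv]
  · ring
  · rw [abs_of_nonneg (by positivity), inv_mul_eq_div, one_le_div hr]
    exact hw.le

namespace IsDispersalKernel

variable {d : ℝ} {J : Plane → ℝ}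

/-- The logarithm is `L`-harmonic at distance more than `d` from the origin. -/
lemma kernelAvg_log (hJ : IsDispersalKernel d J) {x : Plane} (hx : d < ‖x‖) :
    kernelAvg J (fun y => Real.log ‖y‖) x = Real.log ‖x‖ := by
  have hd := hJ.d_pos
  set e := Complex.orthonormalBasisOneI.repr with he
  obtain ⟨w, rfl⟩ := e.surjective x
  rw [e.norm_map] at hx ⊢
  have hne : ∀ z : ℂ, ‖z‖ ≤ d → ‖z - w‖ ≠ 0 := by
    intro z hz h
    rw [norm_eq_zero, sub_eq_zero] at h
    rw [h] at hz
    linarith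
  have hcJ : Continuous fun z => J (e z) := hJ.continuous.comp e.continuous
  have hclog : ContinuousOn (fun z : ℂ => Real.log ‖z - w‖) (Metric.closedBall 0 d) := by
    apply ContinuousOn.log
    · fun_prop
    · intro z hz
      exact hne z (by simpa using hz)
  have hzero : ∫ z : ℂ, J (e z) * (Real.log ‖z - w‖ - Real.log ‖w‖) = 0 := by
    apply integral_eq_zero_of_circleAverage_eq_zero (d := d)
    · exact hcJ.continuousOn.mul (hclog.sub continuousOn_const)
    · intro z hz
      rw [hJ.eq_zero _ (by rwa [e.norm_map]), zero_mul]
    · intro r hr hrd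
      -- Radial symmetry makes `J` constant on each circle, so it leaves the circle average.
      have h1 : Real.circleAverage (fun z => J (e z) * (Real.log ‖z - w‖ - Real.log ‖w‖)) 0 r
          = Real.circleAverage (fun z => J (e r) • (Real.log ‖z - w‖ - Real.log ‖w‖)) 0 r := by
        apply Real.circleAverage_congr_sphere
        intro z hz
        have : J (e z) = J (e r) := by
          apply hJ.radial
          simp only [e.norm_map]
          simp only [mem_sphere_iff_norm, sub_zero] at hz
          rw [hz, Complex.norm_real, Real.norm_eq_abs]
        simp only [this, smul_eq_mul]
      rw [h1, Real.circleAverage_fun_smul]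
      have h2 : Real.circleAverage (fun z => Real.log ‖z - w‖ - Real.log ‖w‖) 0 r = 0 := by
        have := Real.circleAverage_fun_sub (f₁ := fun z : ℂ => Real.log ‖z - w‖)
          (f₂ := fun _ => Real.log ‖w‖) (c := 0) (R := r)
          (circleIntegrable_log_norm_sub_const r) (circleIntegrable_const _ _ _)
        rw [this, circleAverage_log_norm_sub_of_lt hr (hrd.trans hx), Real.circleAverage_const,
          sub_self]
      rw [h2, smul_zero]
  have hmp : MeasurePreserving e volume volume := e.measurePreserving
  have hme : MeasurableEmbedding e := e.toHomeomorph.measurableEmbedding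
  have hsub : ∫ t, J t * (Real.log ‖e w - t‖ - Real.log ‖w‖) = 0 := by
    rw [← hmp.integral_comp hme, ← hzero]
    congr with z
    rw [← map_sub, e.norm_map, norm_sub_rev]
  have hint : Integrable fun t => J t * Real.log ‖e w - t‖ := by
    rw [← hmp.integrable_comp_emb hme]
    have h1 : IntegrableOn (fun z => J (e z) * Real.log ‖z - w‖) (Metric.closedBall 0 d) :=
      (hcJ.continuousOn.mul hclog).integrableOn_compact (isCompact_closedBall _ _)
    rw [← integrableOn_univ]
    refine IntegrableOn.congr_fun (f := fun z => J (e z) * Real.log ‖z - w‖) ?_ ?_ MeasurableSet.univ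
    · refine h1.of_forall_sdiff_eq_zero MeasurableSet.univ ?_
      rintro z ⟨-, hz⟩
      rw [hJ.eq_zero, zero_mul]
      simp only [Metric.mem_closedBall, dist_zero_right, not_le] at hz
      rw [e.norm_map]
      exact hz.le
    · intro z _
      simp only [Function.comp_apply]
      rw [← map_sub, e.norm_map, norm_sub_rev]
  rw [kernelAvg_eq_integral_sub]
  simp only [mul_sub] at hsub
  rw [integral_sub hint (hJ.integrable.mul_const _), integral_mul_const, hJ.integral_eq_one,
    one_mul, sub_eq_zero] at hsub
  exact hsub

end IsDispersalKernel

/-! ### Existence of the stationary solution by a Neumann series. -/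

/-- A measurable function dominated by an affine function of the norm is locally integrable. -/
lemma locallyIntegrable_of_abs_le_norm_add {g : Plane → ℝ} (hg : AEStronglyMeasurable g) (C : ℝ)
    (hC : ∀ᵐ x, |g x| ≤ ‖x‖ + C) : LocallyIntegrable g := by
  have hF : LocallyIntegrable (fun x : Plane => ‖x‖ + C) :=
    (by fun_prop : Continuous fun x : Plane => ‖x‖ + C).locallyIntegrable
  refine hF.mono hg ?_
  filter_upwards [hC] with x hx
  exact hx.trans (le_abs_self _)

/-- The average `J * f`, set to zero in the hole. -/
noncomputable def killedAvg (J : Plane → ℝ) (H : Set Plane) (f : Plane → ℝ) : Plane → ℝ :=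
  Hᶜ.indicator (kernelAvg J f)

/-- The successive contributions to the solution of `h = g + killedAvg J H h`. -/
noncomputable def killedIter (J : Plane → ℝ) (H : Set Plane) (g : Plane → ℝ) : ℕ → Plane → ℝ
  | 0 => g
  | n + 1 => killedAvg J H (killedIter J H g n)

namespace IsDispersalKernel

variable {d : ℝ} {J : Plane → ℝ} {H : Set Plane}

lemma measurable_killedAvg (hJ : IsDispersalKernel d J) (hH : IsOpen H) {f : Plane → ℝ}
    (hf : LocallyIntegrable f) : Measurable (killedAvg J H f) :=
  (hJ.continuous_kernelAvg hf).measurable.indicator hH.measurableSet.compl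

lemma abs_kernelAvg_le (hJ : IsDispersalKernel d J) {f k : Plane → ℝ} (hf : LocallyIntegrable f)
    (hk : LocallyIntegrable k) (h : ∀ x, |f x| ≤ k x) (x : Plane) :
    |kernelAvg J f x| ≤ kernelAvg J k x := by
  rw [abs_le]
  constructor
  · have := hJ.kernelAvg_mono (hk.smul (-1 : ℝ)) hf
      (Eventually.of_forall fun y => by
        simp only [Pi.smul_apply, smul_eq_mul]; linarith [neg_abs_le (f y), h y]) x
    have e : kernelAvg J ((-1 : ℝ) • k) x = -1 * kernelAvg J k x := kernelAvg_const_mul J (-1) k x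
    linarith
  · exact hJ.kernelAvg_mono hf hk (Eventually.of_forall fun y => (le_abs_self _).trans (h y)) x

lemma abs_killedAvg_le (hJ : IsDispersalKernel d J) {f k : Plane → ℝ} (hf : LocallyIntegrable f)
    (hk : LocallyIntegrable k) (h : ∀ x, |f x| ≤ k x) (x : Plane) :
    |killedAvg J H f x| ≤ killedAvg J H k x := by
  by_cases hx : x ∈ Hᶜ
  · simp only [killedAvg, Set.indicator_of_mem hx]
    exact hJ.abs_kernelAvg_le hf hk h x
  · simp only [killedAvg, Set.indicator_of_notMem hx, abs_zero, le_refl]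

lemma killedAvg_le_of_le (hJ : IsDispersalKernel d J) {f : Plane → ℝ} (hf : LocallyIntegrable f)
    {c : ℝ} (hc : 0 ≤ c) (h : ∀ᵐ x, f x ≤ c) (x : Plane) : killedAvg J H f x ≤ c := by
  by_cases hx : x ∈ Hᶜ
  · simp only [killedAvg, Set.indicator_of_mem hx]
    rw [← hJ.kernelAvg_const c x]
    exact hJ.kernelAvg_mono hf (locallyIntegrable_const c) h x
  · simpa only [killedAvg, Set.indicator_of_notMem hx]

lemma killedIter_facts (hJ : IsDispersalKernel d J) (hH : IsOpen H) {g : Plane → ℝ}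
    (hg : Measurable g) {c : ℝ} (hc : ∀ x, |g x| ≤ c) (n : ℕ) :
    Measurable (killedIter J H g n) ∧ ∀ x, |killedIter J H g n x| ≤ c := by
  induction n with
  | zero => exact ⟨hg, hc⟩
  | succ n ih =>
    have hc0 : 0 ≤ c := (abs_nonneg _).trans (hc 0)
    have hl := locallyIntegrable_of_bound ih.1.aestronglyMeasurable c (Eventually.of_forall ih.2)
    refine ⟨hJ.measurable_killedAvg hH hl, fun x => ?_⟩
    refine (hJ.abs_killedAvg_le hl (locallyIntegrable_const c) ih.2 x).trans ?_
    exact hJ.killedAvg_le_of_le (locallyIntegrable_const c) hc0 (Eventually.of_forall fun _ => le_rfl) x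

lemma locallyIntegrable_killedIter (hJ : IsDispersalKernel d J) (hH : IsOpen H) {g : Plane → ℝ}
    (hg : Measurable g) {c : ℝ} (hc : ∀ x, |g x| ≤ c) (n : ℕ) :
    LocallyIntegrable (killedIter J H g n) :=
  have h := hJ.killedIter_facts hH hg hc n
  locallyIntegrable_of_bound h.1.aestronglyMeasurable c (Eventually.of_forall h.2)

lemma killedAvg_sum (hJ : IsDispersalKernel d J) {f : ℕ → Plane → ℝ}
    (hf : ∀ n, LocallyIntegrable (f n)) (N : ℕ) (x : Plane) :
    killedAvg J H (fun y => ∑ n ∈ Finset.range N, f n y) x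
      = ∑ n ∈ Finset.range N, killedAvg J H (f n) x := by
  by_cases hx : x ∈ Hᶜ
  · simp only [killedAvg, Set.indicator_of_mem hx, kernelAvg, Finset.mul_sum]
    exact integral_finsetSum _ fun n _ => hJ.integrable_mul (hf n) x
  · simp only [killedAvg, Set.indicator_of_notMem hx, Finset.sum_const_zero]

/-- The expected time that the killed random walk spends in a ball is bounded. -/
lemma exists_sum_killedIter_le (hJ : IsDispersalKernel d J) (hH : IsHole H) {k : Plane → ℝ}
    (hk : Measurable k) {c ρ : ℝ} (hk0 : ∀ x, 0 ≤ k x) (hc : ∀ x, k x ≤ c)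
    (hkH : ∀ x ∈ H, k x = 0) (hkρ : ∀ x, ρ ≤ ‖x‖ → k x = 0) :
    ∃ B : ℝ, ∀ N x, ∑ n ∈ Finset.range N, killedIter J H k n x ≤ B := by
  have habs : ∀ x, |k x| ≤ c := fun x => by rw [abs_of_nonneg (hk0 x)]; exact hc x
  have hc0 : 0 ≤ c := (hk0 0).trans (hc 0)
  have hl := hJ.locallyIntegrable_killedIter hH.isOpen hk habs
  have hL : ∀ N, LocallyIntegrable fun x => ∑ n ∈ Finset.range N, killedIter J H k n x := by
    intro N
    have := locallyIntegrable_finsetSum (Finset.range N) (fun n _ => hl n)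
    simpa using this
  obtain ⟨C, hC, δ, hδ, hδ1, h⟩ := hJ.exists_improved_bound ρ
  have hstep : ∀ N x, ∑ n ∈ Finset.range (N + 1), killedIter J H k n x =
      k x + killedAvg J H (fun y => ∑ n ∈ Finset.range N, killedIter J H k n y) x := by
    intro N x
    rw [Finset.sum_range_succ', hJ.killedAvg_sum hl, add_comm]
    rfl
  -- Chosen so that `C c + (1 - δ) (c + B) ≤ B`: the crude bound `c + B` for the next partial sum is
  -- improved back to `B`.
  set B := (C * c + c) / δ with hB
  have hB0 : 0 ≤ B := by positivity
  have hnn : ∀ n x, 0 ≤ killedIter J H k n x := by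
    intro n
    induction n with
    | zero => exact hk0
    | succ n ih =>
      intro x
      exact Set.indicator_nonneg
        (fun y _ => hJ.kernelAvg_nonneg (Eventually.of_forall ih) y) x
  have hbound : ∀ N, (∀ᵐ x, ∑ n ∈ Finset.range N, killedIter J H k n x ≤ B) →
      ∀ x, ∑ n ∈ Finset.range (N + 1), killedIter J H k n x ≤ c + B := by
    intro N ih x
    rw [hstep]
    exact add_le_add (hc x) (hJ.killedAvg_le_of_le (hL N) hB0 ih x)
  have key : ∀ N, ∀ᵐ x, ∑ n ∈ Finset.range N, killedIter J H k n x ≤ B := by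
    intro N
    induction N with
    | zero => simp [hB0]
    | succ N ih =>
      have hle := hbound N ih
      have hz : ∀ x ∈ H, ∑ n ∈ Finset.range (N + 1), killedIter J H k n x = 0 := by
        intro x hx
        rw [hstep, hkH x hx, killedAvg, Set.indicator_of_notMem (by simpa using hx), add_zero]
      have hae := h _ (c + B) c (hL (N + 1)) (by positivity) hc0 (Eventually.of_forall hle)
        (Eventually.of_forall fun x hx => (hz x (hH.ball_two_subset (by simpa using hx))).le)
        (Eventually.of_forall fun x _ _ => by
          by_cases hx : x ∈ H
          · exact Or.inl (hz x hx).le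
          · right
            rw [hstep, killedAvg, Set.indicator_of_mem (show x ∈ Hᶜ from hx)]
            apply add_le_add (hc x)
            apply hJ.kernelAvg_mono (hL N) (hL (N + 1))
            filter_upwards with y
            rw [Finset.sum_range_succ]
            linarith [hnn N y])
      have hCB : C * c + (1 - δ) * (c + B) ≤ B := by
        have : δ * B = C * c + c := by rw [hB]; field_simp
        nlinarith
      filter_upwards [hae] with x hx
      rcases lt_or_ge ‖x‖ ρ with hx' | hx'
      · exact (hx hx').trans hCB
      -- Beyond `ρ` the source is zero, so averaging passes the bound `B` on without loss.
      · rw [hstep, hkρ x hx', zero_add]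
        exact hJ.killedAvg_le_of_le (hL N) hB0 ih x
  refine ⟨c + B, fun N x => ?_⟩
  cases N with
  | zero => simp; positivity
  | succ N => exact hbound N (key N) x

/-- The equation `h = g + J * h` outside the hole, `h = 0` in the hole, has a bounded solution if
`g` is bounded and vanishes near infinity. -/
lemma exists_bounded_solution (hJ : IsDispersalKernel d J) (hH : IsHole H) {g : Plane → ℝ}
    (hg : Measurable g) {c ρ : ℝ} (hc : ∀ x, |g x| ≤ c)
    (hgH : ∀ x ∈ H, g x = 0) (hgρ : ∀ x, ρ ≤ ‖x‖ → g x = 0) :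
    ∃ h : Plane → ℝ, Measurable h ∧ (∃ B, ∀ x, |h x| ≤ B) ∧ (∀ x ∈ H, h x = 0) ∧
      ∀ x ∉ H, h x = g x + kernelAvg J h x := by
  set k : Plane → ℝ := fun x => |g x| with hk
  have hkm : Measurable k := hg.abs
  have hkabs : ∀ x, |k x| ≤ c := fun x => by simpa [hk] using hc x
  obtain ⟨B, hB⟩ := hJ.exists_sum_killedIter_le (ρ := ρ) hH hkm (fun x => abs_nonneg (g x)) hc
    (fun x hx => by simp [hk, hgH x hx]) (fun x hx => by simp [hk, hgρ x hx])
  have hgl := hJ.locallyIntegrable_killedIter hH.isOpen hg hc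
  have hkl := hJ.locallyIntegrable_killedIter hH.isOpen hkm hkabs
  have hdom : ∀ n x, |killedIter J H g n x| ≤ killedIter J H k n x := by
    intro n
    induction n with
    | zero => exact fun x => le_rfl
    | succ n ih => exact hJ.abs_killedAvg_le (hgl n) (hkl n) ih
  have hnn : ∀ n x, 0 ≤ killedIter J H k n x := fun n x => (abs_nonneg _).trans (hdom n x)
  have hsumk : ∀ x, Summable fun n => killedIter J H k n x := fun x =>
    summable_of_sum_range_le (fun n => hnn n x) (fun N => hB N x)
  have hsum : ∀ x, Summable fun n => killedIter J H g n x := fun x =>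
    Summable.of_norm_bounded (hsumk x) (fun n => hdom n x)
  have hHz : ∀ n, ∀ x ∈ H, killedIter J H g n x = 0 := by
    intro n x hx
    cases n with
    | zero => exact hgH x hx
    | succ n => exact Set.indicator_of_notMem (by simpa using hx) _
  refine ⟨fun x => ∑' n, killedIter J H g n x, ?_, ⟨B, fun x => ?_⟩, fun x hx => ?_, fun x hx => ?_⟩
  · refine measurable_of_tendsto_metrizable (f := fun N x => ∑ n ∈ Finset.range N,
      killedIter J H g n x) (fun N => ?_) ?_
    · exact Finset.measurable_fun_sum _ fun n _ => (hJ.killedIter_facts hH.isOpen hg hc n).1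
    · rw [tendsto_pi_nhds]
      exact fun x => (hsum x).hasSum.tendsto_sum_nat
  · have h1 : ‖∑' n, killedIter J H g n x‖ ≤ ∑' n, killedIter J H k n x :=
      tsum_of_norm_bounded (hsumk x).hasSum (fun n => hdom n x)
    exact h1.trans ((hsumk x).tsum_le_of_sum_range_le (fun N => hB N x))
  · simp only [hHz _ x hx, tsum_zero]
  · have hx' : x ∈ Hᶜ := hx
    change ∑' n, killedIter J H g n x = _
    rw [(hsum x).tsum_eq_zero_add]
    have hs : ∀ n, killedIter J H g (n + 1) x = ∫ y, J (x - y) * killedIter J H g n y :=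
      fun n => Set.indicator_of_mem hx' _
    have hsk : ∀ n, killedIter J H k (n + 1) x = ∫ y, J (x - y) * killedIter J H k n y :=
      fun n => Set.indicator_of_mem hx' _
    simp only [hs]
    congr 1
    -- The `n`-th integral is dominated by term `n + 1` of the convergent series built from `|g|`.
    have hS : Summable fun n => ∫ y, ‖J (x - y) * killedIter J H g n y‖ := by
      refine Summable.of_nonneg_of_le (fun n => integral_nonneg fun y => norm_nonneg _) (fun n => ?_)
        ((summable_nat_add_iff 1).2 (hsumk x))
      rw [hsk]
      apply integral_mono (hJ.integrable_mul (hgl n) x).norm (hJ.integrable_mul (hkl n) x)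
      intro y
      simp only [norm_mul, Real.norm_eq_abs, abs_of_nonneg (hJ.nonneg _)]
      exact mul_le_mul_of_nonneg_left (hdom n y) (hJ.nonneg _)
    rw [integral_tsum_of_summable_integral_norm (fun n => hJ.integrable_mul (hgl n) x) hS]
    simp only [kernelAvg, tsum_mul_left]

/-- Existence of the stationary solution with logarithmic growth. -/
lemma exists_isLogStationary (hJ : IsDispersalKernel d J) (hH : IsHole H) :
    ∃ φ, IsLogStationary J H φ := by
  obtain ⟨R, hR, hHR⟩ := hH.subset_ball
  have hd := hJ.d_pos
  have hHm := hH.isOpen.measurableSet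
  set l : Plane → ℝ := Hᶜ.indicator fun x => Real.log ‖x‖ with hl
  have hlm : Measurable l := (Real.measurable_log.comp measurable_norm).indicator hHm.compl
  have htwo : ∀ x ∈ Hᶜ, 2 ≤ ‖x‖ := by
    intro x hx
    by_contra! h
    exact hx (hH.ball_two_subset (by simpa using h))
  have hlabs : ∀ x, |l x| ≤ ‖x‖ := by
    intro x
    by_cases hx : x ∈ Hᶜ
    · have := htwo x hx
      rw [hl, Set.indicator_of_mem hx, abs_of_nonneg (Real.log_nonneg (by linarith))]
      exact Real.log_le_self (norm_nonneg x)
    · rw [hl, Set.indicator_of_notMem hx, abs_zero]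
      exact norm_nonneg x
  have hll : LocallyIntegrable l :=
    locallyIntegrable_of_abs_le_norm_add hlm.aestronglyMeasurable 0
      (Eventually.of_forall fun x => by simpa using hlabs x)
  have hcl := hJ.continuous_kernelAvg hll
  -- This is the defect of the truncated logarithm `l`. It vanishes beyond `R + d`, where the kernel
  -- sees only the full logarithm; a bounded `h` with `h = g + J * h` outside the hole then makes `l
  -- + h` stationary.
  set g : Plane → ℝ := Hᶜ.indicator fun x => kernelAvg J l x - l x with hg
  have hgm : Measurable g := (hcl.measurable.sub hlm).indicator hHm.compl
  have hgH : ∀ x ∈ H, g x = 0 := fun x hx => Set.indicator_of_notMem (by simpa using hx) _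
  have hgρ : ∀ x, R + d ≤ ‖x‖ → g x = 0 := by
    intro x hx
    have hmem : ∀ y : Plane, R ≤ ‖y‖ → y ∈ Hᶜ := by
      intro y hy hyH
      have := hHR hyH
      rw [Metric.mem_ball, dist_zero_right] at this
      linarith
    have hxH : x ∈ Hᶜ := hmem x (by linarith)
    rw [hg, Set.indicator_of_mem hxH]
    have : kernelAvg J l x = kernelAvg J (fun y => Real.log ‖y‖) x := by
      apply hJ.kernelAvg_congr
      intro y hy
      apply Set.indicator_of_mem
      apply hmem
      have := norm_sub_norm_le x y
      linarith
    rw [this, hJ.kernelAvg_log (by linarith), hl, Set.indicator_of_mem hxH, sub_self]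
  obtain ⟨K, hK⟩ := (isCompact_closedBall (0 : Plane) (R + d)).exists_bound_of_continuousOn
    hcl.continuousOn
  have hc : ∀ x, |g x| ≤ max K 0 + (R + d) := by
    intro x
    rcases le_or_gt (R + d) ‖x‖ with hx | hx
    · rw [hgρ x hx, abs_zero]
      have := le_max_right K 0
      linarith
    · by_cases hxH : x ∈ Hᶜ
      · rw [hg, Set.indicator_of_mem hxH]
        have h1 := hK x (by simpa using hx.le)
        rw [Real.norm_eq_abs] at h1
        have h2 := hlabs x
        have h3 := abs_sub (kernelAvg J l x) (l x)
        have := le_max_left K 0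
        linarith
      · rw [hg, Set.indicator_of_notMem hxH, abs_zero]
        have := le_max_right K 0
        linarith
  obtain ⟨h, hm, ⟨B, hB⟩, hhH, heq⟩ := hJ.exists_bounded_solution hH hgm hc hgH hgρ
  have hhl : LocallyIntegrable h :=
    locallyIntegrable_of_bound hm.aestronglyMeasurable B (Eventually.of_forall hB)
  refine ⟨fun x => l x + h x, fun x hx => ?_, fun x hx => ?_, ?_⟩
  · rw [nonlocalOp_eq, hJ.kernelAvg_add hll hhl, heq x hx, hg,
      Set.indicator_of_mem (show x ∈ Hᶜ from hx)]
    ring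
  · rw [hhH x hx, hl, Set.indicator_of_notMem (by simpa using hx), add_zero]
  · refine memLp_top_of_bound (C := B) ?_ ?_
    · exact ((hlm.add hm).sub (Real.measurable_log.comp measurable_norm)).aestronglyMeasurable
    · rw [ae_restrict_iff' hHm.compl]
      filter_upwards with x hx
      rw [hl, Set.indicator_of_mem hx, add_sub_cancel_left]
      exact hB x

end IsDispersalKernel

/-! ### Positivity and uniqueness of the stationary solution. -/

namespace IsHole

variable {H : Set Plane}

lemma two_le_norm (hH : IsHole H) {x : Plane} (hx : x ∉ H) : 2 ≤ ‖x‖ := by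
  by_contra! h
  exact hx (hH.ball_two_subset (by simpa using h))

lemma log_norm_nonneg (hH : IsHole H) {x : Plane} (hx : x ∉ H) : 0 ≤ Real.log ‖x‖ :=
  Real.log_nonneg (by linarith [hH.two_le_norm hx])

end IsHole

namespace IsLogStationary

variable {d : ℝ} {J : Plane → ℝ} {H : Set Plane} {φ ψ : Plane → ℝ}

lemma kernelAvg_eq (hφ : IsLogStationary J H φ) {x : Plane} (hx : x ∉ H) :
    kernelAvg J φ x = φ x := by
  have := hφ.stationary x hx
  rwa [nonlocalOp_eq, sub_eq_zero] at this

lemma exists_bound (hφ : IsLogStationary J H φ) (hH : IsHole H) :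
    ∃ C ≥ 0, ∀ᵐ x, x ∉ H → |φ x - Real.log ‖x‖| ≤ C := by
  have h := hφ.log_behavior
  obtain ⟨C, hC⟩ := eLpNormEssSup_lt_top_iff_isBoundedUnder.1 (by simpa using h.2)
  have hC' := (ae_restrict_iff' hH.isOpen.measurableSet.compl).1 (eventually_map.1 hC)
  refine ⟨C, C.2, ?_⟩
  filter_upwards [hC'] with x hx hxH
  exact_mod_cast hx hxH

lemma aestronglyMeasurable (hφ : IsLogStationary J H φ) (hH : IsHole H) :
    AEStronglyMeasurable φ := by
  have h1 : AEStronglyMeasurable φ (volume.restrict Hᶜ) := by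
    have := hφ.log_behavior.1.add
      (Real.measurable_log.comp measurable_norm).aestronglyMeasurable
    refine this.congr (Eventually.of_forall fun x => ?_)
    simp
  rw [← aestronglyMeasurable_indicator_iff hH.isOpen.measurableSet.compl] at h1
  refine h1.congr (Eventually.of_forall fun x => ?_)
  by_cases hx : x ∈ H
  · rw [Set.indicator_of_notMem (by simpa using hx), hφ.eq_zero x hx]
  · rw [Set.indicator_of_mem (show x ∈ Hᶜ from hx)]

lemma locallyIntegrable (hφ : IsLogStationary J H φ) (hH : IsHole H) : LocallyIntegrable φ := by
  obtain ⟨C, hC0, hC⟩ := hφ.exists_bound hH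
  refine locallyIntegrable_of_abs_le_norm_add (hφ.aestronglyMeasurable hH) C ?_
  filter_upwards [hC] with x hx
  by_cases hxH : x ∈ H
  · rw [hφ.eq_zero x hxH, abs_zero]
    positivity
  · have h1 := hx hxH
    have h2 := abs_add_le (φ x - Real.log ‖x‖) (Real.log ‖x‖)
    rw [sub_add_cancel, abs_of_nonneg (hH.log_norm_nonneg hxH)] at h2
    linarith [Real.log_le_self (norm_nonneg x)]

/-- Outside the hole `-φ ≤ C - log ‖x‖`, which is at most `C` everywhere there and nonpositive once
`‖x‖ ≥ exp C`; so the maximum principle applies to `-φ`. -/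
lemma ae_nonneg (hφ : IsLogStationary J H φ) (hJ : IsDispersalKernel d J) (hH : IsHole H) :
    ∀ᵐ x, 0 ≤ φ x := by
  obtain ⟨C, hC0, hC⟩ := hφ.exists_bound hH
  have hneg : ∀ x, kernelAvg J (fun y => -φ y) x = -kernelAvg J φ x := by
    intro x
    have := kernelAvg_const_mul J (-1) φ x
    simpa using this
  have := hJ.nonpos_of_le_kernelAvg (G := fun x => -φ x) (S := C) (ρ := Real.exp C)
    (hφ.locallyIntegrable hH).neg ?_ ?_ ?_ ?_
  · filter_upwards [this] with x hx
    linarith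
  · filter_upwards [hC] with x hx
    by_cases hxH : x ∈ H
    · rw [hφ.eq_zero x hxH]; linarith
    · have := (abs_le.1 (hx hxH)).1
      linarith [hH.log_norm_nonneg hxH]
  · filter_upwards with x hx
    rw [hφ.eq_zero x (hH.ball_two_subset (by simpa using hx)), neg_zero]
  · filter_upwards [hC] with x hx hρ
    by_cases hxH : x ∈ H
    · rw [hφ.eq_zero x hxH, neg_zero]
    · have h1 := (abs_le.1 (hx hxH)).1
      have h2 := Real.log_le_log (Real.exp_pos C) hρ
      rw [Real.log_exp] at h2
      linarith
  · filter_upwards with x _ _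
    by_cases hxH : x ∈ H
    · left; rw [hφ.eq_zero x hxH, neg_zero]
    · right; rw [hneg, hφ.kernelAvg_eq hxH]

/-- The difference `φ - ψ` is bounded but has no known sign at infinity. Subtracting `ε φ`, which
tends to infinity, makes it nonpositive far out; the maximum principle applies and then `ε → 0`. -/
lemma ae_le (hφ : IsLogStationary J H φ) (hψ : IsLogStationary J H ψ)
    (hJ : IsDispersalKernel d J) (hH : IsHole H) : ∀ᵐ x, φ x ≤ ψ x := by
  obtain ⟨C, hC0, hC⟩ := hφ.exists_bound hH
  obtain ⟨D, hD0, hD⟩ := hψ.exists_bound hH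
  have hφl := hφ.locallyIntegrable hH
  have hψl := hψ.locallyIntegrable hH
  have key : ∀ n : ℕ, ∀ᵐ x, φ x - ψ x - (1 / ((n : ℝ) + 1)) * φ x ≤ 0 := by
    intro n
    set ε : ℝ := 1 / ((n : ℝ) + 1) with hε
    have hε0 : 0 < ε := by positivity
    -- Beyond this radius `φ ≥ (C + D) / ε`, so `ε φ ≥ C + D ≥ φ - ψ`.
    refine hJ.nonpos_of_le_kernelAvg (S := C + D) (ρ := Real.exp (C + (C + D) / ε))
      ((hφl.sub hψl).sub (hφl.smul ε)) ?_ ?_ ?_ ?_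
    · filter_upwards [hC, hD, hφ.ae_nonneg hJ hH] with x hx hx' hx0
      by_cases hxH : x ∈ H
      · rw [hφ.eq_zero x hxH, hψ.eq_zero x hxH]; linarith
      · have h1 := (abs_le.1 (hx hxH)).2
        have h2 := (abs_le.1 (hx' hxH)).1
        have h3 : 0 ≤ ε * φ x := by positivity
        linarith
    · filter_upwards with x hx
      have hxH := hH.ball_two_subset (show x ∈ Metric.ball (0 : Plane) 2 by simpa using hx)
      rw [hφ.eq_zero x hxH, hψ.eq_zero x hxH]; simp
    · filter_upwards [hC, hD] with x hx hx' hρ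
      by_cases hxH : x ∈ H
      · rw [hφ.eq_zero x hxH, hψ.eq_zero x hxH]; simp
      · have h1 := abs_le.1 (hx hxH)
        have h2 := (abs_le.1 (hx' hxH)).1
        have h3 := Real.log_le_log (Real.exp_pos _) hρ
        rw [Real.log_exp] at h3
        have h4 : (C + D) / ε ≤ φ x := by linarith [h1.1]
        rw [div_le_iff₀ hε0] at h4
        linarith [h1.2]
    · filter_upwards with x _ _
      by_cases hxH : x ∈ H
      · left; rw [hφ.eq_zero x hxH, hψ.eq_zero x hxH]; simp
      · right
        rw [hJ.kernelAvg_sub (g := fun x => φ x - ψ x) (h := fun x => ε * φ x) (hφl.sub hψl)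
          (hφl.smul ε), hJ.kernelAvg_sub hφl hψl,
          kernelAvg_const_mul, hφ.kernelAvg_eq hxH, hψ.kernelAvg_eq hxH]
  rw [← ae_all_iff] at key
  filter_upwards [key] with x hx
  have hlim : Tendsto (fun n : ℕ => φ x - ψ x - (1 / ((n : ℝ) + 1)) * φ x) atTop
      (𝓝 (φ x - ψ x - 0 * φ x)) :=
    tendsto_const_nhds.sub (tendsto_one_div_add_atTop_nhds_zero_nat.mul_const _)
  have := le_of_tendsto' hlim hx
  linarith

/-- Equality a.e. becomes pointwise because outside the hole a stationary function equals its own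
average, which depends only on its a.e. class. -/
lemma eq_of_isLogStationary (hφ : IsLogStationary J H φ) (hψ : IsLogStationary J H ψ)
    (hJ : IsDispersalKernel d J) (hH : IsHole H) : φ = ψ := by
  have hae : φ =ᵐ[volume] ψ := by
    filter_upwards [hφ.ae_le hψ hJ hH, hψ.ae_le hφ hJ hH] with x h1 h2
    exact le_antisymm h1 h2
  funext x
  by_cases hx : x ∈ H
  · rw [hφ.eq_zero x hx, hψ.eq_zero x hx]
  · rw [← hφ.kernelAvg_eq hx, ← hψ.kernelAvg_eq hx, kernelAvg_congr_ae J hae]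

end IsLogStationary

/-! ### Linear evolution with a bounded generator as a Poisson mixture. -/

section Semigroup

variable {E : Type*} [NormedAddCommGroup E] [NormedSpace ℝ E] [CompleteSpace E]

lemma exp_neg_mul_exp_clm (A : E →L[ℝ] E) : NormedSpace.exp (-A) * NormedSpace.exp A = 1 := by
  let _ : NormedAlgebra ℚ (E →L[ℝ] E) := NormedAlgebra.restrictScalars ℚ ℝ (E →L[ℝ] E)
  rw [← NormedSpace.exp_add_of_commute (Commute.neg_left (Commute.refl A)), neg_add_cancel,
    NormedSpace.exp_zero]

/-- A curve that is continuous on `[0, ∞)` and solves a linear equation on `(0, ∞)` is given by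
the exponential of the generator. -/
lemma eq_exp_smul_of_hasDerivAt (A : E →L[ℝ] E) {v : ℝ → E} (hc : ContinuousOn v (Set.Ici 0))
    (hd : ∀ t, 0 < t → HasDerivAt v (A (v t)) t) {t : ℝ} (ht : 0 ≤ t) :
    v t = NormedSpace.exp (t • A) (v 0) := by
  set z : ℝ → E := fun s => NormedSpace.exp (s • (-A)) (v s) with hz
  have hexp : ∀ s : ℝ, HasDerivAt (fun r : ℝ => NormedSpace.exp (r • (-A)))
      (NormedSpace.exp (s • (-A)) * (-A)) s := fun s => hasDerivAt_exp_smul_const (-A) s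
  have hzc : ContinuousOn z (Set.Ici 0) := by
    have : Continuous fun r : ℝ => NormedSpace.exp (r • (-A)) :=
      continuous_iff_continuousAt.2 fun s => (hexp s).continuousAt
    exact this.continuousOn.clm_apply hc
  have hzd : ∀ s, 0 < s → HasDerivAt z 0 s := by
    intro s hs
    have := (hexp s).clm_apply (hd s hs)
    simpa [hz] using this
  have hconst : z t = z 0 := by
    rcases ht.eq_or_lt with rfl | ht
    · rfl
    -- The equation is available only at positive times, so `z` is constant on `(0, t]` first;
    -- continuity at `0` adds the endpoint.
    have h1 : ∀ s ∈ Set.Ioc 0 t, z s = z t := by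
      intro s hs
      refine (constant_of_has_deriv_right_zero (a := s) (b := t) (f := z) ?_ ?_ t ⟨hs.2, le_rfl⟩).symm
      · exact hzc.mono fun r hr => hs.1.le.trans hr.1
      · exact fun r hr => (hzd r (hs.1.trans_le hr.1)).hasDerivWithinAt
    have h2 : Tendsto z (𝓝[>] 0) (𝓝 (z 0)) :=
      (hzc 0 Set.self_mem_Ici).tendsto.mono_left (nhdsWithin_mono _ Set.Ioi_subset_Ici_self)
    have h3 : Tendsto z (𝓝[>] 0) (𝓝 (z t)) := by
      refine tendsto_const_nhds.congr' ?_
      filter_upwards [Ioc_mem_nhdsGT ht] with s hs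
      exact (h1 s hs).symm
    exact tendsto_nhds_unique h3 h2
  have h0 : z 0 = v 0 := by simp [hz]
  have h1 : NormedSpace.exp (t • A) (z t) = v t := by
    have := exp_neg_mul_exp_clm (-(t • A))
    rw [neg_neg] at this
    simp only [hz, smul_neg]
    rw [← mul_apply_eq_comp, this, one_apply_eq_self]
  rw [← h1, hconst, h0]

lemma exp_smul_sub_one (T : E →L[ℝ] E) (t : ℝ) :
    NormedSpace.exp (t • (T - 1)) = Real.exp (-t) • NormedSpace.exp (t • T) := by
  let _ : NormedAlgebra ℚ (E →L[ℝ] E) := NormedAlgebra.restrictScalars ℚ ℝ (E →L[ℝ] E)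
  have e : t • (T - 1) = algebraMap ℝ (E →L[ℝ] E) (-t) + t • T := by
    rw [Algebra.algebraMap_eq_smul_one, smul_sub, neg_smul]
    abel
  rw [e, NormedSpace.exp_add_of_commute (Algebra.commutes (-t) (t • T)),
    ← NormedSpace.algebraMap_exp_comm, ← Algebra.smul_def, Real.exp_eq_exp_ℝ]

end Semigroup

/-- The weights of the Poisson distribution with parameter `t`. -/
noncomputable def poissonWeight (t : ℝ) (n : ℕ) : ℝ := Real.exp (-t) * (t ^ n / n.factorial)

lemma poissonWeight_nonneg {t : ℝ} (ht : 0 ≤ t) (n : ℕ) : 0 ≤ poissonWeight t n := by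
  unfold poissonWeight
  positivity

section Semigroup

variable {E : Type*} [NormedAddCommGroup E] [NormedSpace ℝ E] [CompleteSpace E]

/-- The walk is observed after a Poisson number of steps. This reduces statements on the evolution
to statements on the powers of `T`. -/
lemma hasSum_poissonWeight_smul (T : E →L[ℝ] E) (t : ℝ) (x : E) :
    HasSum (fun n => poissonWeight t n • (T ^ n) x) (NormedSpace.exp (t • (T - 1)) x) := by
  let _ : NormedAlgebra ℚ (E →L[ℝ] E) := NormedAlgebra.restrictScalars ℚ ℝ (E →L[ℝ] E)
  rw [exp_smul_sub_one]
  have h := NormedSpace.exp_series_hasSum_exp' (𝕂 := ℝ) (t • T)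
  have h2 := (h.mapL (ContinuousLinearMap.apply ℝ E x)).const_smul (Real.exp (-t))
  have e : (fun n => poissonWeight t n • (T ^ n) x) = fun n => Real.exp (-t) •
      (ContinuousLinearMap.apply ℝ E x) ((n.factorial : ℝ)⁻¹ • (t • T) ^ n) := by
    funext n
    simp only [poissonWeight, ContinuousLinearMap.apply_apply, smul_pow, smul_apply, smul_smul]
    congr 1
    ring
  rw [e]
  exact h2

end Semigroup

section Semigroup

variable {E : Type*} [NormedAddCommGroup E] [NormedSpace ℝ E]

lemma summable_norm_poissonWeight_smul (T : E →L[ℝ] E) (t : ℝ) (x : E) :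
    Summable fun n => ‖poissonWeight t n • (T ^ n) x‖ := by
  have h := NormedSpace.norm_expSeries_summable' (𝕂 := ℝ) (t • T)
  have h2 := (h.mul_right ‖x‖).mul_left (Real.exp (-t))
  refine Summable.of_nonneg_of_le (fun n => norm_nonneg _) (fun n => ?_) h2
  have e : poissonWeight t n • (T ^ n) x =
      Real.exp (-t) • (((n.factorial : ℝ)⁻¹ • (t • T) ^ n) x) := by
    simp only [poissonWeight, smul_pow, smul_apply, smul_smul]
    congr 1
    ring
  rw [e, norm_smul, Real.norm_of_nonneg (Real.exp_pos _).le]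
  exact mul_le_mul_of_nonneg_left (ContinuousLinearMap.le_opNorm _ _) (Real.exp_pos _).le

end Semigroup

/-! ### The killed operator on `L¹` and the Dirichlet problem. -/

namespace IsDispersalKernel

variable {d : ℝ} {J : Plane → ℝ} {H : Set Plane}

lemma locallyIntegrable_Lp (f : Lp ℝ 1 (volume : Measure Plane)) : LocallyIntegrable f :=
  (L1.integrable_coeFn f).locallyIntegrable

lemma integrable_kernelAvg (hJ : IsDispersalKernel d J) {f : Plane → ℝ} (hf : Integrable f) :
    Integrable (kernelAvg J f) := by
  rw [kernelAvg_eq_convolution]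
  exact hJ.integrable.integrable_convolution _ hf

lemma integral_kernelAvg (hJ : IsDispersalKernel d J) {f : Plane → ℝ} (hf : Integrable f) :
    ∫ x, kernelAvg J f x = ∫ x, f x := by
  rw [kernelAvg_eq_convolution, integral_convolution _ hJ.integrable hf, hJ.integral_eq_one]
  simp

lemma integrable_killedAvg (hJ : IsDispersalKernel d J) (hH : IsOpen H) {f : Plane → ℝ}
    (hf : Integrable f) : Integrable (killedAvg J H f) :=
  (hJ.integrable_kernelAvg hf).indicator hH.measurableSet.compl

/-- The operator `f ↦ 1_{ℝ² \ H} (J * f)` as a bounded operator on `L¹`. -/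
lemma exists_killedConv (hJ : IsDispersalKernel d J) (hH : IsOpen H) :
    ∃ T : Lp ℝ 1 (volume : Measure Plane) →L[ℝ] Lp ℝ 1 (volume : Measure Plane),
      ∀ f, T f =ᵐ[volume] killedAvg J H f := by
  have hint : ∀ f : Lp ℝ 1 (volume : Measure Plane), Integrable (killedAvg J H f) :=
    fun f => hJ.integrable_killedAvg hH (L1.integrable_coeFn f)
  let T₀ : Lp ℝ 1 (volume : Measure Plane) →ₗ[ℝ] Lp ℝ 1 (volume : Measure Plane) :=
    { toFun := fun f => (hint f).toL1 _
      map_add' := by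
        intro f g
        apply Lp.ext
        filter_upwards [(hint (f + g)).coeFn_toL1, (hint f).coeFn_toL1, (hint g).coeFn_toL1,
          Lp.coeFn_add ((hint f).toL1 _) ((hint g).toL1 _)] with x h1 h2 h3 h4
        rw [h1, h4, Pi.add_apply, h2, h3]
        by_cases hx : x ∈ Hᶜ
        · simp only [killedAvg, Set.indicator_of_mem hx]
          rw [kernelAvg_congr_ae J (Lp.coeFn_add f g)]
          exact hJ.kernelAvg_add (locallyIntegrable_Lp f) (locallyIntegrable_Lp g) x
        · simp only [killedAvg, Set.indicator_of_notMem hx, add_zero]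
      map_smul' := by
        intro c f
        apply Lp.ext
        filter_upwards [(hint (c • f)).coeFn_toL1, (hint f).coeFn_toL1,
          Lp.coeFn_smul c ((hint f).toL1 _)] with x h1 h2 h4
        rw [h1, RingHom.id_apply, h4, Pi.smul_apply, h2]
        by_cases hx : x ∈ Hᶜ
        · simp only [killedAvg, Set.indicator_of_mem hx]
          rw [kernelAvg_congr_ae J (Lp.coeFn_smul c f)]
          exact kernelAvg_const_mul J c f x
        · simp only [killedAvg, Set.indicator_of_notMem hx, smul_zero] }
  refine ⟨T₀.mkContinuous 1 fun f => ?_, fun f => (hint f).coeFn_toL1⟩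
  rw [one_mul, L1.norm_eq_integral_norm, L1.norm_eq_integral_norm]
  have hf := L1.integrable_coeFn f
  have hfl := locallyIntegrable_Lp f
  calc ∫ x, ‖T₀ f x‖ = ∫ x, |killedAvg J H f x| := by
        apply integral_congr_ae
        filter_upwards [(hint f).coeFn_toL1] with x hx
        rw [← hx]; rfl
    _ ≤ ∫ x, kernelAvg J (fun y => ‖f y‖) x := by
        apply integral_mono (hint f).abs (hJ.integrable_kernelAvg hf.norm)
        intro x
        by_cases hx : x ∈ Hᶜ
        · simp only [killedAvg, Set.indicator_of_mem hx]
          exact hJ.abs_kernelAvg_le hfl hf.norm.locallyIntegrable (fun _ => le_rfl) x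
        · simp only [killedAvg, Set.indicator_of_notMem hx, abs_zero]
          exact hJ.kernelAvg_nonneg (Eventually.of_forall fun y => norm_nonneg _) x
    _ = ∫ x, ‖f x‖ := hJ.integral_kernelAvg hf.norm

end IsDispersalKernel

/-- In `L¹`, a Dirichlet solution solves a linear equation with a bounded generator. -/
lemma IsDirichletSolution.hasDerivAt {J : Plane → ℝ} {H : Set Plane} {u₀ : Plane → ℝ}
    {u : ℝ → Lp ℝ 1 (volume : Measure Plane)} (hu : IsDirichletSolution J H u₀ u) (hH : IsOpen H)
    {T : Lp ℝ 1 (volume : Measure Plane) →L[ℝ] Lp ℝ 1 (volume : Measure Plane)}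
    (hT : ∀ f, T f =ᵐ[volume] killedAvg J H f) {t : ℝ} (ht : 0 < t) :
    HasDerivAt u ((T - 1) (u t)) t := by
  obtain ⟨w, hw, hweq⟩ := hu.equation t ht
  -- The equation says nothing about `w` in the hole. There, restriction to `H` is a bounded linear
  -- map that sends the curve to zero near `t`, hence also its derivative.
  have hres : ∀ᵐ x : Plane, x ∈ H → w x = 0 := by
    set R := LpToLpRestrictCLM Plane ℝ ℝ volume 1 H
    have hR : ∀ f : Lp ℝ 1 (volume : Measure Plane),
        R f = 0 ↔ ∀ᵐ x : Plane, x ∈ H → f x = 0 := by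
      intro f
      rw [← ae_restrict_iff' hH.measurableSet, Lp.eq_zero_iff_ae_eq_zero]
      have := LpToLpRestrictCLM_coeFn (𝕜 := ℝ) H f
      exact ⟨fun h => by filter_upwards [h, this] with x h1 h2; rw [← h2, h1]; rfl,
        fun h => by filter_upwards [h, this] with x h1 h2; rw [h2, h1]; rfl⟩
    rw [← hR]
    have h1 : HasDerivAt (fun s => R (u s)) (R w) t := R.hasFDerivAt.comp_hasDerivAt t hw
    have h2 : HasDerivAt (fun s => R (u s)) 0 t := by
      refine (hasDerivAt_const t (0 : Lp ℝ 1 (volume.restrict H))).congr_of_eventuallyEq ?_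
      filter_upwards [lt_mem_nhds ht] with s hs
      exact (hR _).2 (hu.dirichlet s hs)
    exact h1.unique h2
  have : w = (T - 1) (u t) := by
    apply Lp.ext
    rw [sub_apply, one_apply_eq_self]
    filter_upwards [hweq, hres, hT (u t), Lp.coeFn_sub (T (u t)) (u t), hu.dirichlet t ht]
      with x h1 h2 h3 h4 h5
    rw [h4, Pi.sub_apply, h3]
    by_cases hx : x ∈ H
    · rw [h2 hx, h5 hx, killedAvg, Set.indicator_of_notMem (by simpa using hx), sub_zero]
    · rw [h1 hx, nonlocalOp_eq, killedAvg, Set.indicator_of_mem (show x ∈ Hᶜ from hx)]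
  rwa [← this]

section Iterates

variable {d : ℝ} {J : Plane → ℝ} {H : Set Plane}
  {T : Lp ℝ 1 (volume : Measure Plane) →L[ℝ] Lp ℝ 1 (volume : Measure Plane)}
  {U : Lp ℝ 1 (volume : Measure Plane)}

lemma ae_nonneg_pow_apply (hJ : IsDispersalKernel d J)
    (hT : ∀ f, T f =ᵐ[volume] killedAvg J H f) (hU : ∀ᵐ x, 0 ≤ U x) (n : ℕ) :
    ∀ᵐ x, 0 ≤ (T ^ n) U x := by
  induction n with
  | zero => simpa using hU
  | succ n ih =>
    rw [pow_succ', mul_apply_eq_comp]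
    filter_upwards [hT ((T ^ n) U)] with x hx
    rw [hx]
    exact Set.indicator_nonneg (fun y _ => hJ.kernelAvg_nonneg ih y) x

lemma ae_eq_zero_pow_apply (hT : ∀ f, T f =ᵐ[volume] killedAvg J H f)
    (hU : ∀ᵐ x, x ∈ H → U x = 0) (n : ℕ) : ∀ᵐ x, x ∈ H → (T ^ n) U x = 0 := by
  cases n with
  | zero => simpa using hU
  | succ n =>
    rw [pow_succ', mul_apply_eq_comp]
    filter_upwards [hT ((T ^ n) U)] with x hx hxH
    rw [hx]
    exact Set.indicator_of_notMem (by simpa using hxH) _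

/-- Absolute convergence in `L¹` implies convergence a.e. to the same sum, so signs and zeros of the
iterates pass to the solution. -/
lemma ae_hasSum_poissonWeight
    (T : Lp ℝ 1 (volume : Measure Plane) →L[ℝ] Lp ℝ 1 (volume : Measure Plane))
    (U : Lp ℝ 1 (volume : Measure Plane)) (t : ℝ) :
    ∀ᵐ x, HasSum (fun n => poissonWeight t n * (T ^ n) U x)
      (NormedSpace.exp (t • (T - 1)) U x) := by
  have hs : ∑' n, ‖poissonWeight t n • (T ^ n) U‖ₑ ≠ ⊤ := by
    have := (summable_norm_poissonWeight_smul T t U).tsum_ofReal_ne_top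
    simpa only [ofReal_norm] using this
  have h1 := Lp.hasSum_coeFn_tsum hs
  rw [(hasSum_poissonWeight_smul T t U).tsum_eq] at h1
  have h2 : ∀ᵐ x, ∀ n, (poissonWeight t n • (T ^ n) U : Lp ℝ 1 (volume : Measure Plane)) x
      = poissonWeight t n * (T ^ n) U x := by
    rw [ae_all_iff]
    exact fun n => Lp.coeFn_smul (poissonWeight t n) ((T ^ n) U)
  filter_upwards [h1, h2] with x hx1 hx2
  simpa only [hx2] using hx1

lemma isDirichletSolution_exp {u₀ : Plane → ℝ}
    (hT : ∀ f, T f =ᵐ[volume] killedAvg J H f) (hU0 : U =ᵐ[volume] u₀)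
    (hU : ∀ᵐ x, x ∈ H → U x = 0) :
    IsDirichletSolution J H u₀ fun t => NormedSpace.exp (t • (T - 1)) U := by
  have hderiv : ∀ t : ℝ, HasDerivAt (fun s : ℝ => NormedSpace.exp (s • (T - 1)) U)
      ((T - 1) (NormedSpace.exp (t • (T - 1)) U)) t := by
    intro t
    have := (hasDerivAt_exp_smul_const' (T - 1) t).clm_apply (hasDerivAt_const t U)
    simpa only [map_zero, add_zero, mul_apply_eq_comp] using this
  refine ⟨fun t _ => (hderiv t).continuousAt.continuousWithinAt, fun t _ => ⟨_, hderiv t, ?_⟩,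
    fun t _ => ?_, ?_⟩
  · set f := NormedSpace.exp (t • (T - 1)) U
    rw [sub_apply, one_apply_eq_self]
    filter_upwards [hT f, Lp.coeFn_sub (T f) f] with x h1 h2 hx
    rw [h2, Pi.sub_apply, h1, nonlocalOp_eq, killedAvg,
      Set.indicator_of_mem (show x ∈ Hᶜ from hx)]
  · have hz : ∀ᵐ x, ∀ n, x ∈ H → (T ^ n) U x = 0 :=
      ae_all_iff.2 fun n => ae_eq_zero_pow_apply hT hU n
    filter_upwards [ae_hasSum_poissonWeight T U t, hz] with x h1 h2 hx
    have : (fun n => poissonWeight t n * (T ^ n) U x) = fun _ => 0 := by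
      funext n
      rw [h2 n hx, mul_zero]
    rw [this] at h1
    exact h1.unique hasSum_zero
  · filter_upwards [hU0] with x hx
    simpa using hx

end Iterates

/-! ### Generating function and mean of the Poisson weights. -/

section PoissonWeights

lemma hasSum_poissonWeight_mul_pow (t ρ : ℝ) :
    HasSum (fun n => poissonWeight t n * ρ ^ n) (Real.exp (-(t * (1 - ρ)))) := by
  have h := (NormedSpace.expSeries_div_hasSum_exp (𝔸 := ℝ) (t * ρ)).mul_left (Real.exp (-t))
  rw [← Real.exp_eq_exp_ℝ, ← Real.exp_add] at h
  have e1 : -t + t * ρ = -(t * (1 - ρ)) := by ring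
  rw [e1] at h
  have e2 : (fun n => poissonWeight t n * ρ ^ n) =
      fun n : ℕ => Real.exp (-t) * ((t * ρ) ^ n / n.factorial) := by
    funext n
    rw [poissonWeight, mul_pow]
    ring
  rw [e2]
  exact h

lemma hasSum_poissonWeight (t : ℝ) : HasSum (poissonWeight t) 1 := by
  simpa using hasSum_poissonWeight_mul_pow t 1

lemma hasSum_poissonWeight_mul_nat (t : ℝ) :
    HasSum (fun n => poissonWeight t n * (n : ℝ)) t := by
  rw [← hasSum_nat_add_iff' 1]
  simp only [Finset.range_one, Finset.sum_singleton, Nat.cast_zero, mul_zero, sub_zero]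
  have h := (hasSum_poissonWeight t).mul_left t
  rw [mul_one] at h
  have e : (fun n : ℕ => poissonWeight t (n + 1) * ((n + 1 : ℕ) : ℝ)) =
      fun n => t * poissonWeight t n := by
    funext n
    simp only [poissonWeight, Nat.factorial_succ, Nat.cast_mul, pow_succ]
    field_simp
  rw [e]
  exact h

end PoissonWeights

/-! ### Duality: conservation of the `φ`-moment and comparison with the free walk. -/

namespace IsDispersalKernel

variable {d : ℝ} {J : Plane → ℝ} {H : Set Plane}

/-- Duality for the averaging operator, in the extended nonnegative reals. -/
lemma lintegral_killedAvg_mul (hJ : IsDispersalKernel d J) (hH : IsOpen H) {f : Plane → ℝ}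
    (hfm : Measurable f) (hfl : LocallyIntegrable f) (hf : ∀ᵐ x, 0 ≤ f x)
    {G : Plane → ENNReal} (hG : Measurable G) :
    ∫⁻ x, ENNReal.ofReal (killedAvg J H f x) * G x =
      ∫⁻ y, ENNReal.ofReal (f y) * ∫⁻ x in Hᶜ, ENNReal.ofReal (J (x - y)) * G x := by
  have hJm : Measurable J := hJ.continuous.measurable
  have h1 : ∀ x, ENNReal.ofReal (killedAvg J H f x) * G x =
      ∫⁻ y, Hᶜ.indicator G x * (ENNReal.ofReal (J (x - y)) * ENNReal.ofReal (f y)) := by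
    intro x
    have hm : Measurable fun y => ENNReal.ofReal (J (x - y)) * ENNReal.ofReal (f y) := by fun_prop
    rw [lintegral_const_mul _ hm]
    by_cases hx : x ∈ Hᶜ
    · simp only [killedAvg, Set.indicator_of_mem hx]
      rw [kernelAvg, ofReal_integral_eq_lintegral_ofReal (hJ.integrable_mul hfl x)
        (by filter_upwards [hf] with y hy using mul_nonneg (hJ.nonneg _) hy), mul_comm]
      simp only [ENNReal.ofReal_mul (hJ.nonneg _)]
    · simp only [killedAvg, Set.indicator_of_notMem hx, ENNReal.ofReal_zero, zero_mul]
  simp only [h1]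
  rw [lintegral_lintegral_swap]
  · congr with y
    have hm : Measurable fun x => Hᶜ.indicator G x * ENNReal.ofReal (J (x - y)) :=
      (hG.indicator hH.measurableSet.compl).mul (by fun_prop)
    simp only [← mul_assoc]
    rw [lintegral_mul_const _ hm, mul_comm, ← lintegral_indicator hH.measurableSet.compl]
    congr 2 with x
    by_cases hx : x ∈ Hᶜ
    · simp only [Set.indicator_of_mem hx, mul_comm]
    · simp only [Set.indicator_of_notMem hx, zero_mul]
  · apply Measurable.aemeasurable
    have : Measurable (Hᶜ.indicator G) := hG.indicator hH.measurableSet.compl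
    simp only [Function.uncurry_def]
    fun_prop

/-- Discarding the killing only increases the integral of a nonnegative test function; by symmetry
of `J` what remains is the free average. -/
lemma lintegral_killedAvg_mul_le (hJ : IsDispersalKernel d J) (hH : IsOpen H) {f : Plane → ℝ}
    (hfm : Measurable f) (hfl : LocallyIntegrable f) (hf : ∀ᵐ x, 0 ≤ f x)
    {G : Plane → ℝ} (hG : Continuous G) (hG0 : ∀ x, 0 ≤ G x) :
    ∫⁻ x, ENNReal.ofReal (killedAvg J H f x) * ENNReal.ofReal (G x) ≤
      ∫⁻ y, ENNReal.ofReal (f y) * ENNReal.ofReal (kernelAvg J G y) := by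
  rw [hJ.lintegral_killedAvg_mul hH hfm hfl hf hG.measurable.ennreal_ofReal]
  refine lintegral_mono fun y => ?_
  gcongr
  refine (setLIntegral_le_lintegral _ _).trans (le_of_eq ?_)
  rw [kernelAvg, ofReal_integral_eq_lintegral_ofReal (hJ.integrable_mul hG.locallyIntegrable y)
    (Eventually.of_forall fun x => mul_nonneg (hJ.nonneg _) (hG0 x))]
  congr with x
  rw [ENNReal.ofReal_mul (hJ.nonneg _), hJ.sub_comm]

/-- No mass is lost against `φ`: the killed region carries no weight because `φ = 0` there, and `J *
φ = φ` wherever `f` lives. -/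
lemma lintegral_killedAvg_mul_stationary (hJ : IsDispersalKernel d J) (hH : IsHole H)
    {φ f : Plane → ℝ} (hφ : IsLogStationary J H φ)
    (hfm : Measurable f) (hfl : LocallyIntegrable f) (hf : ∀ᵐ x, 0 ≤ f x)
    (hfH : ∀ᵐ x, x ∈ H → f x = 0) :
    ∫⁻ x, ENNReal.ofReal (killedAvg J H f x) * ENNReal.ofReal (φ x) =
      ∫⁻ y, ENNReal.ofReal (f y) * ENNReal.ofReal (φ y) := by
  have hφm := (hφ.aestronglyMeasurable hH).aemeasurable
  have hφ0 := hφ.ae_nonneg hJ hH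
  have h1 : ∫⁻ x, ENNReal.ofReal (killedAvg J H f x) * ENNReal.ofReal (φ x) =
      ∫⁻ x, ENNReal.ofReal (killedAvg J H f x) * ENNReal.ofReal (hφm.mk φ x) := by
    apply lintegral_congr_ae
    filter_upwards [hφm.ae_eq_mk] with x hx
    rw [← hx]
  rw [h1, hJ.lintegral_killedAvg_mul hH.isOpen hfm hfl hf hφm.measurable_mk.ennreal_ofReal]
  apply lintegral_congr_ae
  filter_upwards [hfH] with y hy
  by_cases hyH : y ∈ H
  · rw [hy hyH, ENNReal.ofReal_zero, zero_mul, zero_mul]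
  congr 1
  rw [← hφ.kernelAvg_eq hyH, kernelAvg, ofReal_integral_eq_lintegral_ofReal
    (hJ.integrable_mul (hφ.locallyIntegrable hH) y)
    (by filter_upwards [hφ0] with x hx using mul_nonneg (hJ.nonneg _) hx),
    ← lintegral_indicator hH.isOpen.measurableSet.compl]
  apply lintegral_congr_ae
  filter_upwards [hφm.ae_eq_mk] with x hx
  rw [ENNReal.ofReal_mul (hJ.nonneg _), hJ.sub_comm y x]
  by_cases hxH : x ∈ H
  · rw [Set.indicator_of_notMem (by simpa using hxH), hφ.eq_zero x hxH, ENNReal.ofReal_zero,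
      mul_zero]
  · rw [Set.indicator_of_mem (show x ∈ Hᶜ from hxH), ← hx]

end IsDispersalKernel

section Moments

variable {d : ℝ} {J : Plane → ℝ} {H : Set Plane}
  {T : Lp ℝ 1 (volume : Measure Plane) →L[ℝ] Lp ℝ 1 (volume : Measure Plane)}
  {U : Lp ℝ 1 (volume : Measure Plane)}

/-- Extended nonnegative integrals allow the exchange of sum and integral before any moment of the
solution is known to be finite. -/
lemma lintegral_exp_mul (hJ : IsDispersalKernel d J)
    (hT : ∀ f, T f =ᵐ[volume] killedAvg J H f) (hU : ∀ᵐ x, 0 ≤ U x) {t : ℝ} (ht : 0 ≤ t)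
    {G : Plane → ENNReal} (hG : AEMeasurable G) :
    ∫⁻ x, ENNReal.ofReal (NormedSpace.exp (t • (T - 1)) U x) * G x =
      ∑' n, ENNReal.ofReal (poissonWeight t n) * ∫⁻ x, ENNReal.ofReal ((T ^ n) U x) * G x := by
  have hm : ∀ n, AEMeasurable fun x => ENNReal.ofReal ((T ^ n) U x) * G x := fun n =>
    (Lp.stronglyMeasurable _).measurable.ennreal_ofReal.aemeasurable.mul hG
  have hpos : ∀ᵐ x, ∀ n, 0 ≤ (T ^ n) U x :=
    ae_all_iff.2 fun n => ae_nonneg_pow_apply hJ hT hU n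
  simp only [← lintegral_const_mul'' _ (hm _)]
  rw [← lintegral_tsum fun n => (hm n).const_mul _]
  apply lintegral_congr_ae
  filter_upwards [ae_hasSum_poissonWeight T U t, hpos] with x h1 h2
  have h3 : ∀ n, 0 ≤ poissonWeight t n * (T ^ n) U x := fun n =>
    mul_nonneg (poissonWeight_nonneg ht n) (h2 n)
  rw [← h1.tsum_eq, ENNReal.ofReal_tsum_of_nonneg h3 h1.summable, ← ENNReal.tsum_mul_right]
  congr with n
  rw [ENNReal.ofReal_mul (poissonWeight_nonneg ht n), mul_assoc]

lemma ae_nonneg_exp (hJ : IsDispersalKernel d J)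
    (hT : ∀ f, T f =ᵐ[volume] killedAvg J H f) (hU : ∀ᵐ x, 0 ≤ U x) {t : ℝ} (ht : 0 ≤ t) :
    ∀ᵐ x, 0 ≤ NormedSpace.exp (t • (T - 1)) U x := by
  have hpos : ∀ᵐ x, ∀ n, 0 ≤ (T ^ n) U x :=
    ae_all_iff.2 fun n => ae_nonneg_pow_apply hJ hT hU n
  filter_upwards [ae_hasSum_poissonWeight T U t, hpos] with x h1 h2
  exact h1.nonneg fun n => mul_nonneg (poissonWeight_nonneg ht n) (h2 n)

/-- The integral against the stationary solution is conserved. -/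
lemma lintegral_exp_mul_stationary (hJ : IsDispersalKernel d J) (hH : IsHole H) {φ : Plane → ℝ}
    (hφ : IsLogStationary J H φ) (hT : ∀ f, T f =ᵐ[volume] killedAvg J H f)
    (hU : ∀ᵐ x, 0 ≤ U x) (hUH : ∀ᵐ x, x ∈ H → U x = 0) {t : ℝ} (ht : 0 ≤ t) :
    ∫⁻ x, ENNReal.ofReal (NormedSpace.exp (t • (T - 1)) U x) * ENNReal.ofReal (φ x) =
      ∫⁻ x, ENNReal.ofReal (U x) * ENNReal.ofReal (φ x) := by
  rw [lintegral_exp_mul hJ hT hU ht (hφ.aestronglyMeasurable hH).aemeasurable.ennreal_ofReal]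
  have hn : ∀ n, ∫⁻ x, ENNReal.ofReal ((T ^ n) U x) * ENNReal.ofReal (φ x) =
      ∫⁻ x, ENNReal.ofReal (U x) * ENNReal.ofReal (φ x) := by
    intro n
    induction n with
    | zero => simp
    | succ n ih =>
      rw [← ih, ← hJ.lintegral_killedAvg_mul_stationary hH hφ
        (Lp.stronglyMeasurable _).measurable
        (IsDispersalKernel.locallyIntegrable_Lp _) (ae_nonneg_pow_apply hJ hT hU n)
        (ae_eq_zero_pow_apply hT hUH n)]
      apply lintegral_congr_ae
      rw [pow_succ', mul_apply_eq_comp]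
      filter_upwards [hT ((T ^ n) U)] with x hx
      rw [hx]
  simp only [hn]
  rw [ENNReal.tsum_mul_right, ← ENNReal.ofReal_tsum_of_nonneg (poissonWeight_nonneg ht)
    (hasSum_poissonWeight t).summable, (hasSum_poissonWeight t).tsum_eq, ENNReal.ofReal_one, one_mul]

/-- Upper bound for the integral of the solution against the first element of a sequence of test
functions `G n` with `J * G n ≤ G (n + 1)`. -/
lemma lintegral_exp_mul_le (hJ : IsDispersalKernel d J) (hH : IsOpen H)
    (hT : ∀ f, T f =ᵐ[volume] killedAvg J H f) (hU : ∀ᵐ x, 0 ≤ U x) {t : ℝ} (ht : 0 ≤ t)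
    {G : ℕ → Plane → ℝ} (hGc : ∀ n, Continuous (G n)) (hG0 : ∀ n x, 0 ≤ G n x)
    (hG : ∀ n x, kernelAvg J (G n) x ≤ G (n + 1) x) {B : ℕ → Plane → ℝ}
    (hB : ∀ n, Measurable (B n)) (hGB : ∀ n x, G n x ≤ B n x) {S : Plane → ℝ}
    (hS : ∀ x, HasSum (fun n => poissonWeight t n * B n x) (S x)) :
    ∫⁻ x, ENNReal.ofReal (NormedSpace.exp (t • (T - 1)) U x) * ENNReal.ofReal (G 0 x) ≤
      ∫⁻ x, ENNReal.ofReal (U x) * ENNReal.ofReal (S x) := by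
  -- Each factor `T` moved onto the test function raises its index by one, so the induction needs
  -- every starting index `k`.
  have key : ∀ n k, ∫⁻ x, ENNReal.ofReal ((T ^ n) U x) * ENNReal.ofReal (G k x) ≤
      ∫⁻ x, ENNReal.ofReal (U x) * ENNReal.ofReal (G (k + n) x) := by
    intro n
    induction n with
    | zero => intro k; simp
    | succ n ih =>
      intro k
      have e : ∫⁻ x, ENNReal.ofReal ((T ^ (n + 1)) U x) * ENNReal.ofReal (G k x) =
          ∫⁻ x, ENNReal.ofReal (killedAvg J H ((T ^ n) U) x) * ENNReal.ofReal (G k x) := by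
        apply lintegral_congr_ae
        rw [pow_succ', mul_apply_eq_comp]
        filter_upwards [hT ((T ^ n) U)] with x hx
        rw [hx]
      rw [e]
      refine (hJ.lintegral_killedAvg_mul_le hH (Lp.stronglyMeasurable _).measurable
        (IsDispersalKernel.locallyIntegrable_Lp _) (ae_nonneg_pow_apply hJ hT hU n) (hGc k)
        (hG0 k)).trans ?_
      have h2 := ih (k + 1)
      rw [show k + 1 + n = k + (n + 1) by ring] at h2
      refine le_trans (lintegral_mono fun x => ?_) h2
      gcongr
      exact hG k x
  have hUm : Measurable U := (Lp.stronglyMeasurable U).measurable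
  rw [lintegral_exp_mul hJ hT hU ht (hGc 0).measurable.ennreal_ofReal.aemeasurable]
  have hS' : ∀ x, ENNReal.ofReal (U x) * ENNReal.ofReal (S x) =
      ∑' n, ENNReal.ofReal (poissonWeight t n) *
        (ENNReal.ofReal (U x) * ENNReal.ofReal (B n x)) := by
    intro x
    rw [← (hS x).tsum_eq, ENNReal.ofReal_tsum_of_nonneg (fun n =>
      mul_nonneg (poissonWeight_nonneg ht n) ((hG0 n x).trans (hGB n x))) (hS x).summable,
      ← ENNReal.tsum_mul_left]
    congr with n
    rw [ENNReal.ofReal_mul (poissonWeight_nonneg ht n), mul_left_comm]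
  simp only [hS']
  have hm : ∀ n, Measurable fun x => ENNReal.ofReal (U x) * ENNReal.ofReal (B n x) := fun n =>
    hUm.ennreal_ofReal.mul (hB n).ennreal_ofReal
  rw [lintegral_tsum fun n => ((hm n).const_mul _).aemeasurable]
  apply ENNReal.tsum_le_tsum
  intro n
  rw [lintegral_const_mul _ (hm n)]
  refine mul_le_mul' le_rfl ?_
  have := key n 0
  rw [zero_add] at this
  refine this.trans (lintegral_mono fun x => ?_)
  gcongr
  exact hGB n x

end Moments

/-! ### Test functions: the square of the norm and the Fejér kernel. -/

/-- The Fourier transform of the kernel in the direction of the first coordinate. -/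
noncomputable def kernelCos (J : Plane → ℝ) (ζ : ℝ) : ℝ := ∫ t, J t * Real.cos (ζ * t 0)

namespace IsDispersalKernel

variable {d : ℝ} {J : Plane → ℝ}

/-- Averaging the contributions of `t` and `-t` cancels the cross term by the parallelogram law, and
`‖t‖ < d` on the support of `J`. -/
lemma kernelAvg_normSq_le (hJ : IsDispersalKernel d J) (x : Plane) :
    kernelAvg J (fun y => ‖y‖ ^ 2) x ≤ ‖x‖ ^ 2 + d ^ 2 := by
  have hl : LocallyIntegrable fun y : Plane => ‖y‖ ^ 2 :=
    (by fun_prop : Continuous fun y : Plane => ‖y‖ ^ 2).locallyIntegrable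
  have h1 := hJ.integrable_mul_sub hl x
  have h2 : Integrable fun t => J t * ‖x + t‖ ^ 2 := by
    have := h1.comp_neg
    simpa only [hJ.neg, sub_neg_eq_add] using this
  have e1 : kernelAvg J (fun y => ‖y‖ ^ 2) x = ∫ t, J t * ‖x - t‖ ^ 2 :=
    kernelAvg_eq_integral_sub J _ x
  have e2 : kernelAvg J (fun y => ‖y‖ ^ 2) x = ∫ t, J t * ‖x + t‖ ^ 2 := by
    rw [e1, ← integral_neg_eq_self]
    simp only [hJ.neg, sub_neg_eq_add]
  have h3 : (∫ t, J t * ‖x - t‖ ^ 2) + ∫ t, J t * ‖x + t‖ ^ 2 ≤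
      ∫ t, J t * (2 * (‖x‖ ^ 2 + d ^ 2)) := by
    rw [← integral_add h1 h2]
    apply integral_mono (h1.add h2) (hJ.integrable.mul_const _)
    intro t
    have hp := parallelogram_law_with_norm ℝ x t
    have e : J t * ‖x - t‖ ^ 2 + J t * ‖x + t‖ ^ 2 = J t * (2 * (‖x‖ ^ 2 + ‖t‖ ^ 2)) := by
      rw [← mul_add]
      congr 1
      nlinarith
    change J t * ‖x - t‖ ^ 2 + J t * ‖x + t‖ ^ 2 ≤ J t * (2 * (‖x‖ ^ 2 + d ^ 2))
    rw [e]
    rcases lt_or_ge ‖t‖ d with ht | ht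
    · have := hJ.nonneg t
      have := norm_nonneg t
      gcongr
    · simp only [hJ.eq_zero t ht, zero_mul, le_refl]
  rw [integral_mul_const, hJ.integral_eq_one, ← e1, ← e2] at h3
  linarith

lemma integrable_mul_continuous (hJ : IsDispersalKernel d J) {g : Plane → ℝ}
    (hg : Continuous g) : Integrable fun t => J t * g t :=
  (hJ.continuous.mul hg).integrable_of_hasCompactSupport hJ.hasCompactSupport.mul_right

/-- Cosines are eigenfunctions of the averaging operator. -/
lemma kernelAvg_cos (hJ : IsDispersalKernel d J) (ζ : ℝ) (x : Plane) :
    kernelAvg J (fun y => Real.cos (ζ * y 0)) x = kernelCos J ζ * Real.cos (ζ * x 0) := by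
  have hsin : ∫ t, J t * Real.sin (ζ * t 0) = 0 := by
    have h := integral_neg_eq_self (fun t => J t * Real.sin (ζ * t 0)) (volume : Measure Plane)
    simp only [hJ.neg, PiLp.neg_apply, mul_neg, Real.sin_neg, integral_neg] at h
    linarith
  have hc : Integrable fun t => J t * Real.cos (ζ * t 0) :=
    hJ.integrable_mul_continuous (by fun_prop)
  have hs : Integrable fun t => J t * Real.sin (ζ * t 0) :=
    hJ.integrable_mul_continuous (by fun_prop)
  rw [kernelAvg_eq_integral_sub]
  have e : ∀ t : Plane, J t * Real.cos (ζ * (x - t) 0) =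
      J t * Real.cos (ζ * t 0) * Real.cos (ζ * x 0) +
        J t * Real.sin (ζ * t 0) * Real.sin (ζ * x 0) := by
    intro t
    rw [PiLp.sub_apply, mul_sub, Real.cos_sub]
    ring
  simp only [e]
  rw [integral_add (hc.mul_const _) (hs.mul_const _), integral_mul_const, integral_mul_const,
    hsin, zero_mul, add_zero, kernelCos]

lemma kernelCos_zero (hJ : IsDispersalKernel d J) : kernelCos J 0 = 1 := by
  simp [kernelCos, hJ.integral_eq_one]

lemma abs_apply_zero_le (t : Plane) : |t 0| ≤ ‖t‖ := by
  simpa using PiLp.norm_apply_le t 0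

lemma kernelCos_nonneg (hJ : IsDispersalKernel d J) {ζ : ℝ} (hζ : |ζ| * d ≤ 1) :
    0 ≤ kernelCos J ζ := by
  apply integral_nonneg
  intro t
  rcases lt_or_ge ‖t‖ d with ht | ht
  · apply mul_nonneg (hJ.nonneg t)
    have h1 : |ζ * t 0| ≤ 1 := by
      rw [abs_mul]
      refine le_trans ?_ hζ
      exact mul_le_mul_of_nonneg_left ((abs_apply_zero_le t).trans ht.le) (abs_nonneg _)
    rw [← Real.cos_abs]
    exact (Real.cos_pos_of_le_one (by rwa [abs_abs])).le
  · simp [hJ.eq_zero t ht]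

/-- Quadratic decay of the Fourier transform of the kernel near the origin. -/
lemma exists_kernelCos_le (hJ : IsDispersalKernel d J) :
    ∃ c > 0, ∀ ζ : ℝ, |ζ| * d ≤ 1 → kernelCos J ζ ≤ 1 - c * ζ ^ 2 := by
  have hd := hJ.d_pos
  have hq : Integrable fun t : Plane => J t * (t 0) ^ 2 :=
    hJ.integrable_mul_continuous (by fun_prop)
  have hqpos : 0 < ∫ t : Plane, J t * (t 0) ^ 2 := by
    rw [integral_pos_iff_support_of_nonneg _ hq]
    · set W : Set Plane := Metric.ball 0 d ∩ {t | t 0 ≠ 0}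
      have hW : IsOpen W := by
        apply Metric.isOpen_ball.inter
        exact isOpen_ne_fun (by fun_prop) continuous_const
      have hne : W.Nonempty := by
        refine ⟨EuclideanSpace.single 0 (d / 2), ?_, ?_⟩
        · rw [Metric.mem_ball, dist_zero_right, PiLp.norm_single, Real.norm_eq_abs,
            abs_of_pos (by positivity)]
          linarith
        · simp [hd.ne']
      refine (hW.measure_pos volume hne).trans_le (measure_mono ?_)
      rintro t ⟨ht1, ht2⟩
      rw [Metric.mem_ball, dist_zero_right] at ht1
      have := hJ.pos t ht1
      have ht3 : t 0 ≠ 0 := ht2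
      rw [Function.mem_support]
      positivity
    · exact fun t => mul_nonneg (hJ.nonneg t) (sq_nonneg _)
  -- The constant comes from `cos u ≤ 1 - (2 / π²) u²` for `|u| ≤ π`.
  refine ⟨2 / Real.pi ^ 2 * ∫ t : Plane, J t * (t 0) ^ 2, by positivity, fun ζ hζ => ?_⟩
  have hc : Integrable fun t => J t * Real.cos (ζ * t 0) :=
    hJ.integrable_mul_continuous (by fun_prop)
  have h1 : kernelCos J ζ ≤ ∫ t, (J t - (2 / Real.pi ^ 2 * ζ ^ 2) * (J t * (t 0) ^ 2)) := by
    apply integral_mono hc (hJ.integrable.sub (hq.const_mul _))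
    intro t
    rcases lt_or_ge ‖t‖ d with ht | ht
    · have h1 : |ζ * t 0| ≤ 1 := by
        rw [abs_mul]
        refine le_trans ?_ hζ
        exact mul_le_mul_of_nonneg_left ((abs_apply_zero_le t).trans ht.le) (abs_nonneg _)
      have h2 := Real.cos_le_one_sub_mul_cos_sq (h1.trans (by linarith [Real.pi_gt_three]))
      have h3 := mul_le_mul_of_nonneg_left h2 (hJ.nonneg t)
      refine h3.trans (le_of_eq ?_)
      change _ = J t - 2 / Real.pi ^ 2 * ζ ^ 2 * (J t * (t 0) ^ 2)
      ring
    · simp [hJ.eq_zero t ht]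
  rw [integral_sub hJ.integrable (hq.const_mul _), integral_const_mul, hJ.integral_eq_one] at h1
  linarith

end IsDispersalKernel

/-- The averages of the Fejér-type kernel `N⁻² |∑_{j<N} exp(i j ξ x₀)|²`. -/
noncomputable def fejerIter (J : Plane → ℝ) (N : ℕ) (ξ : ℝ) (n : ℕ) (x : Plane) : ℝ :=
  ((N : ℝ) ^ 2)⁻¹ * ∑ j ∈ Finset.range N, ∑ k ∈ Finset.range N,
    kernelCos J (((j : ℝ) - k) * ξ) ^ n * Real.cos (((j : ℝ) - k) * ξ * x 0)

lemma continuous_fejerIter (J : Plane → ℝ) (N : ℕ) (ξ : ℝ) (n : ℕ) :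
    Continuous (fejerIter J N ξ n) := by
  unfold fejerIter
  fun_prop

/-- The double sum is `|∑ exp (i j ξ x₀)|²`, a sum of two squares. -/
lemma fejerIter_zero_nonneg (J : Plane → ℝ) (N : ℕ) (ξ : ℝ) (x : Plane) :
    0 ≤ fejerIter J N ξ 0 x := by
  have e : ∑ j ∈ Finset.range N, ∑ k ∈ Finset.range N,
      kernelCos J (((j : ℝ) - k) * ξ) ^ 0 * Real.cos (((j : ℝ) - k) * ξ * x 0) =
      (∑ j ∈ Finset.range N, Real.cos (j * (ξ * x 0))) ^ 2 +
        (∑ j ∈ Finset.range N, Real.sin (j * (ξ * x 0))) ^ 2 := by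
    rw [sq, sq, Finset.sum_mul_sum, Finset.sum_mul_sum, ← Finset.sum_add_distrib]
    refine Finset.sum_congr rfl fun j _ => ?_
    rw [← Finset.sum_add_distrib]
    refine Finset.sum_congr rfl fun k _ => ?_
    rw [pow_zero, one_mul, ← Real.cos_sub]
    congr 1
    ring
  rw [fejerIter, e]
  positivity

lemma half_le_fejerIter_zero (J : Plane → ℝ) {N : ℕ} (hN : 0 < N) {ξ : ℝ} (hξ : 0 ≤ ξ) {x : Plane}
    (hx : N * ξ * ‖x‖ ≤ 1) : 1 / 2 ≤ fejerIter J N ξ 0 x := by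
  have hN' : (0 : ℝ) < N := by exact_mod_cast hN
  have h : ∑ j ∈ Finset.range N, ∑ k ∈ Finset.range N, (1 / 2 : ℝ) ≤
      ∑ j ∈ Finset.range N, ∑ k ∈ Finset.range N,
      kernelCos J (((j : ℝ) - k) * ξ) ^ 0 * Real.cos (((j : ℝ) - k) * ξ * x 0) := by
    refine Finset.sum_le_sum fun j hj => Finset.sum_le_sum fun k hk => ?_
    rw [pow_zero, one_mul]
    have hj' : (j : ℝ) ≤ N := by exact_mod_cast (Finset.mem_range.1 hj).le
    have hk' : (k : ℝ) ≤ N := by exact_mod_cast (Finset.mem_range.1 hk).le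
    have h1 : |(j : ℝ) - k| ≤ N := by
      rw [abs_le]
      constructor <;> linarith [Nat.cast_nonneg (α := ℝ) j, Nat.cast_nonneg (α := ℝ) k]
    have h2 : |((j : ℝ) - k) * ξ * x 0| ≤ 1 := by
      rw [abs_mul, abs_mul, abs_of_nonneg hξ]
      refine le_trans ?_ hx
      gcongr
      exact IsDispersalKernel.abs_apply_zero_le x
    have h3 := Real.one_sub_sq_div_two_le_cos (x := ((j : ℝ) - k) * ξ * x 0)
    have h4 := (sq_le_one_iff_abs_le_one _).2 h2
    linarith
  simp only [Finset.sum_const, Finset.card_range, nsmul_eq_mul] at h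
  rw [fejerIter]
  calc (1 / 2 : ℝ) = ((N : ℝ) ^ 2)⁻¹ * (N * (N * (1 / 2))) := by field_simp
    _ ≤ _ := by gcongr

namespace IsDispersalKernel

variable {d : ℝ} {J : Plane → ℝ}

lemma kernelAvg_fejerIter (hJ : IsDispersalKernel d J) (N : ℕ) (ξ : ℝ) (n : ℕ) (x : Plane) :
    kernelAvg J (fejerIter J N ξ n) x = fejerIter J N ξ (n + 1) x := by
  have hint : ∀ j k : ℕ, Integrable fun y => J (x - y) *
      (kernelCos J (((j : ℝ) - k) * ξ) ^ n * Real.cos (((j : ℝ) - k) * ξ * y 0)) := fun j k =>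
    hJ.integrable_mul ((by fun_prop : Continuous fun y : Plane =>
      kernelCos J (((j : ℝ) - k) * ξ) ^ n *
        Real.cos (((j : ℝ) - k) * ξ * y 0)).locallyIntegrable) x
  unfold fejerIter
  rw [kernelAvg_const_mul]
  congr 1
  simp only [kernelAvg, Finset.mul_sum]
  rw [integral_finsetSum _ fun j _ => integrable_finsetSum _ fun k _ => hint j k]
  refine Finset.sum_congr rfl fun j _ => ?_
  rw [integral_finsetSum _ fun k _ => hint j k]
  refine Finset.sum_congr rfl fun k _ => ?_
  have h1 := kernelAvg_const_mul J (kernelCos J (((j : ℝ) - k) * ξ) ^ n)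
    (fun y => Real.cos (((j : ℝ) - k) * ξ * y 0)) x
  rw [hJ.kernelAvg_cos] at h1
  rw [pow_succ, mul_assoc]
  exact h1

/-- For `n > 0` the sum is no longer a visible square; positivity is inherited by averaging from `n
= 0`. -/
lemma fejerIter_nonneg (hJ : IsDispersalKernel d J) (N : ℕ) (ξ : ℝ) (n : ℕ) (x : Plane) :
    0 ≤ fejerIter J N ξ n x := by
  induction n generalizing x with
  | zero => exact fejerIter_zero_nonneg J N ξ x
  | succ n ih =>
    rw [← hJ.kernelAvg_fejerIter]
    exact hJ.kernelAvg_nonneg (Eventually.of_forall ih) x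

/-- The `N` diagonal terms contribute `1 / N`. Off the diagonal `|j - k| ≥ 1`, so each coefficient
lies between `0` and `(1 - c ξ²) ^ n`, and there are at most `N²` of them. -/
lemma fejerIter_le (hJ : IsDispersalKernel d J) {c : ℝ} (hc : 0 < c)
    (hcos : ∀ ζ : ℝ, |ζ| * d ≤ 1 → kernelCos J ζ ≤ 1 - c * ζ ^ 2) {N : ℕ} (hN : 0 < N) {ξ : ℝ}
    (hξ : 0 ≤ ξ) (hξd : N * ξ * d ≤ 1) (n : ℕ) (x : Plane) :
    fejerIter J N ξ n x ≤ (N : ℝ)⁻¹ + |1 - c * ξ ^ 2| ^ n := by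
  have hd := hJ.d_pos
  have hN' : (0 : ℝ) < N := by exact_mod_cast hN
  set ρ := |1 - c * ξ ^ 2| with hρ
  have hρ0 : 0 ≤ ρ := abs_nonneg _
  have h : ∑ j ∈ Finset.range N, ∑ k ∈ Finset.range N,
      kernelCos J (((j : ℝ) - k) * ξ) ^ n * Real.cos (((j : ℝ) - k) * ξ * x 0) ≤
      ∑ j ∈ Finset.range N, ∑ k ∈ Finset.range N, ((if j = k then 1 else 0) + ρ ^ n) := by
    refine Finset.sum_le_sum fun j hj => Finset.sum_le_sum fun k hk => ?_
    have hj' : (j : ℝ) ≤ N := by exact_mod_cast (Finset.mem_range.1 hj).le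
    have hk' : (k : ℝ) ≤ N := by exact_mod_cast (Finset.mem_range.1 hk).le
    split_ifs with hjk
    · subst hjk
      have := pow_nonneg hρ0 n
      simp [hJ.kernelCos_zero, this]
    · have h1 : |(j : ℝ) - k| ≤ N := by
        rw [abs_le]
        constructor <;> linarith [Nat.cast_nonneg (α := ℝ) j, Nat.cast_nonneg (α := ℝ) k]
      have h2 : |((j : ℝ) - k) * ξ| * d ≤ 1 := by
        rw [abs_mul, abs_of_nonneg hξ]
        refine le_trans ?_ hξd
        gcongr
      have h3 : 1 ≤ ((j : ℝ) - k) ^ 2 := by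
        have : (1 : ℤ) ≤ ((j : ℤ) - k) ^ 2 := by
          have : (j : ℤ) - k ≠ 0 := by
            intro h
            apply hjk
            omega
          exact (one_le_sq_iff_one_le_abs _).mpr (Int.one_le_abs this)
        exact_mod_cast this
      have h4 : kernelCos J (((j : ℝ) - k) * ξ) ≤ ρ := by
        refine (hcos _ h2).trans (le_trans ?_ (le_abs_self _))
        rw [mul_pow]
        have : c * (1 * ξ ^ 2) ≤ c * (((j : ℝ) - k) ^ 2 * ξ ^ 2) := by gcongr
        linarith
      have h5 := hJ.kernelCos_nonneg h2
      have h6 := pow_le_pow_left₀ h5 h4 n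
      have h7 := mul_le_mul_of_nonneg_left (Real.cos_le_one (((j : ℝ) - k) * ξ * x 0))
        (pow_nonneg h5 n)
      linarith
  have e : ∑ j ∈ Finset.range N, ∑ k ∈ Finset.range N, ((if j = k then (1 : ℝ) else 0) + ρ ^ n) =
      N + N * (N * ρ ^ n) := by
    simp only [Finset.sum_add_distrib, Finset.sum_const, Finset.card_range, nsmul_eq_mul,
      Finset.sum_ite_eq, Finset.sum_ite_mem, Finset.inter_self, mul_one]
  rw [e] at h
  rw [fejerIter]
  calc _ ≤ ((N : ℝ) ^ 2)⁻¹ * (N + N * (N * ρ ^ n)) := by gcongr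
    _ = _ := by field_simp

end IsDispersalKernel

/-! ### Second moment of the solution and its mass in a ball. -/

section Moments

variable {d : ℝ} {J : Plane → ℝ} {H : Set Plane}
  {T : Lp ℝ 1 (volume : Measure Plane) →L[ℝ] Lp ℝ 1 (volume : Measure Plane)}
  {U : Lp ℝ 1 (volume : Measure Plane)}

lemma integrable_and_integral_le_of_lintegral_le {f : Plane → ℝ} (hfm : AEStronglyMeasurable f)
    (hf : ∀ᵐ x, 0 ≤ f x) {a : ℝ} (ha : 0 ≤ a)
    (h : ∫⁻ x, ENNReal.ofReal (f x) ≤ ENNReal.ofReal a) : Integrable f ∧ ∫ x, f x ≤ a := by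
  have hi : Integrable f :=
    ⟨hfm, (hasFiniteIntegral_iff_ofReal hf).2 (h.trans_lt ENNReal.ofReal_lt_top)⟩
  refine ⟨hi, ?_⟩
  rwa [← ENNReal.ofReal_le_ofReal_iff ha, ofReal_integral_eq_lintegral_ofReal hi hf]

lemma integral_exp_mul_stationary (hJ : IsDispersalKernel d J) (hH : IsHole H) {φ : Plane → ℝ}
    (hφ : IsLogStationary J H φ) (hT : ∀ f, T f =ᵐ[volume] killedAvg J H f)
    (hU : ∀ᵐ x, 0 ≤ U x) (hUH : ∀ᵐ x, x ∈ H → U x = 0) (hUφ : Integrable fun x => U x * φ x)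
    {t : ℝ} (ht : 0 ≤ t) :
    Integrable (fun x => NormedSpace.exp (t • (T - 1)) U x * φ x) ∧
      ∫ x, NormedSpace.exp (t • (T - 1)) U x * φ x = ∫ x, U x * φ x := by
  have hφ0 := hφ.ae_nonneg hJ hH
  have hv := ae_nonneg_exp hJ hT hU ht
  have h := lintegral_exp_mul_stationary hJ hH hφ hT hU hUH ht
  set v := NormedSpace.exp (t • (T - 1)) U
  have e : ∀ w : Lp ℝ 1 (volume : Measure Plane), (∀ᵐ x, 0 ≤ w x) →
      ∫⁻ x, ENNReal.ofReal (w x) * ENNReal.ofReal (φ x) = ∫⁻ x, ENNReal.ofReal (w x * φ x) := by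
    intro w hw
    apply lintegral_congr_ae
    filter_upwards [hw] with x hx
    rw [ENNReal.ofReal_mul hx]
  have hnn : ∀ w : Lp ℝ 1 (volume : Measure Plane), (∀ᵐ x, 0 ≤ w x) →
      ∀ᵐ x, 0 ≤ w x * φ x := by
    intro w hw
    filter_upwards [hw, hφ0] with x h1 h2 using mul_nonneg h1 h2
  have hUn := hnn U hU
  rw [e v hv, e U hU, ← ofReal_integral_eq_lintegral_ofReal hUφ hUn] at h
  have hvm : AEStronglyMeasurable fun x => v x * φ x :=
    (Lp.aestronglyMeasurable v).mul (hφ.aestronglyMeasurable hH)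
  have hi := (integrable_and_integral_le_of_lintegral_le hvm (hnn v hv)
    (integral_nonneg_of_ae hUn) h.le).1
  refine ⟨hi, ?_⟩
  rw [← ofReal_integral_eq_lintegral_ofReal hi (hnn v hv)] at h
  exact (ENNReal.ofReal_eq_ofReal_iff (integral_nonneg_of_ae (hnn v hv))
    (integral_nonneg_of_ae hUn)).1 h

lemma integral_exp_mul_le (hJ : IsDispersalKernel d J) (hH : IsOpen H)
    (hT : ∀ f, T f =ᵐ[volume] killedAvg J H f) (hU : ∀ᵐ x, 0 ≤ U x) {t : ℝ} (ht : 0 ≤ t)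
    {G : ℕ → Plane → ℝ} (hGc : ∀ n, Continuous (G n)) (hG0 : ∀ n x, 0 ≤ G n x)
    (hG : ∀ n x, kernelAvg J (G n) x ≤ G (n + 1) x) {B : ℕ → Plane → ℝ}
    (hB : ∀ n, Measurable (B n)) (hGB : ∀ n x, G n x ≤ B n x) {S : Plane → ℝ}
    (hS : ∀ x, HasSum (fun n => poissonWeight t n * B n x) (S x))
    (hUS : Integrable fun x => U x * S x) :
    Integrable (fun x => NormedSpace.exp (t • (T - 1)) U x * G 0 x) ∧
      ∫ x, NormedSpace.exp (t • (T - 1)) U x * G 0 x ≤ ∫ x, U x * S x := by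
  have hv := ae_nonneg_exp hJ hT hU ht
  have h := lintegral_exp_mul_le hJ hH hT hU ht hGc hG0 hG hB hGB hS
  set v := NormedSpace.exp (t • (T - 1)) U
  have hS0 : ∀ x, 0 ≤ S x := fun x => (hS x).nonneg fun n =>
    mul_nonneg (poissonWeight_nonneg ht n) ((hG0 n x).trans (hGB n x))
  have hUn : ∀ᵐ x, 0 ≤ U x * S x := hU.mono fun x hx => mul_nonneg hx (hS0 x)
  have e1 : ∫⁻ x, ENNReal.ofReal (U x) * ENNReal.ofReal (S x) =
      ENNReal.ofReal (∫ x, U x * S x) := by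
    rw [ofReal_integral_eq_lintegral_ofReal hUS hUn]
    apply lintegral_congr_ae
    filter_upwards [hU] with x hx
    rw [ENNReal.ofReal_mul hx]
  have e2 : ∫⁻ x, ENNReal.ofReal (v x) * ENNReal.ofReal (G 0 x) =
      ∫⁻ x, ENNReal.ofReal (v x * G 0 x) := by
    apply lintegral_congr_ae
    filter_upwards [hv] with x hx
    rw [ENNReal.ofReal_mul hx]
  rw [e1, e2] at h
  exact integrable_and_integral_le_of_lintegral_le
    ((Lp.aestronglyMeasurable v).mul (hGc 0).aestronglyMeasurable)
    (hv.mono fun x hx => mul_nonneg hx (hG0 0 x)) (integral_nonneg_of_ae hUn) h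

/-- Each step adds at most `d²` to the second moment, and the mean number of steps is `t`. -/
lemma integral_exp_mul_normSq_le (hJ : IsDispersalKernel d J) (hH : IsOpen H)
    (hT : ∀ f, T f =ᵐ[volume] killedAvg J H f) (hU : ∀ᵐ x, 0 ≤ U x)
    (hU2 : Integrable fun x => U x * ‖x‖ ^ 2) {t : ℝ} (ht : 0 ≤ t) :
    Integrable (fun x => NormedSpace.exp (t • (T - 1)) U x * ‖x‖ ^ 2) ∧
      ∫ x, NormedSpace.exp (t • (T - 1)) U x * ‖x‖ ^ 2 ≤
        (∫ x, U x * ‖x‖ ^ 2) + (d ^ 2 * ∫ x, U x) * t := by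
  have hUi := L1.integrable_coeFn U
  have hc : Continuous fun x : Plane => ‖x‖ ^ 2 := by fun_prop
  have hUS : Integrable fun x => U x * (‖x‖ ^ 2 + t * d ^ 2) := by
    simp only [mul_add]
    exact hU2.add (hUi.mul_const _)
  have h := integral_exp_mul_le hJ hH hT hU ht
    (G := fun n x => ‖x‖ ^ 2 + n * d ^ 2) (B := fun n x => ‖x‖ ^ 2 + n * d ^ 2)
    (S := fun x => ‖x‖ ^ 2 + t * d ^ 2) (fun n => by fun_prop) (fun n x => by positivity)
    (fun n x => by
      rw [hJ.kernelAvg_add hc.locallyIntegrable (locallyIntegrable_const _), hJ.kernelAvg_const]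
      push_cast
      linarith [hJ.kernelAvg_normSq_le x])
    (fun n => by fun_prop) (fun n x => le_rfl)
    (fun x => by
      have h1 := (hasSum_poissonWeight t).mul_right (‖x‖ ^ 2)
      have h2 := (hasSum_poissonWeight_mul_nat t).mul_right (d ^ 2)
      have h3 := h1.add h2
      rw [one_mul] at h3
      simpa only [mul_add, mul_assoc] using h3) hUS
  simp only [Nat.cast_zero, zero_mul, add_zero] at h
  refine ⟨h.1, h.2.trans (le_of_eq ?_)⟩
  simp only [mul_add]
  rw [integral_add hU2 (hUi.mul_const _), integral_mul_const]
  ring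

/-- The mass of the solution in a ball, compared with the free random walk. -/
lemma setIntegral_ball_exp_le (hJ : IsDispersalKernel d J) (hH : IsOpen H)
    (hT : ∀ f, T f =ᵐ[volume] killedAvg J H f) (hU : ∀ᵐ x, 0 ≤ U x) {c : ℝ} (hc : 0 < c)
    (hcos : ∀ ζ : ℝ, |ζ| * d ≤ 1 → kernelCos J ζ ≤ 1 - c * ζ ^ 2) {N : ℕ} (hN : 0 < N) {ξ r : ℝ}
    (hξ : 0 ≤ ξ) (hξd : N * ξ * d ≤ 1) (hξr : N * ξ * r ≤ 1) {t : ℝ} (ht : 0 ≤ t) :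
    ∫ x in Metric.ball (0 : Plane) r, NormedSpace.exp (t • (T - 1)) U x ≤
      2 * (((N : ℝ)⁻¹ + Real.exp (-(t * (c * ξ ^ 2)))) * ∫ x, U x) := by
  have hd := hJ.d_pos
  have hUi := L1.integrable_coeFn U
  have hv := ae_nonneg_exp hJ hT hU ht
  have hN1 : (1 : ℝ) ≤ N := by exact_mod_cast hN
  -- Forced by `0 ≤ kernelCos J ξ ≤ 1 - c ξ²`; it removes the absolute value from the Fejér bound.
  have hcξ : c * ξ ^ 2 ≤ 1 := by
    have h1 : |ξ| * d ≤ 1 := by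
      rw [abs_of_nonneg hξ]
      refine le_trans ?_ hξd
      rw [mul_assoc]
      exact le_mul_of_one_le_left (by positivity) hN1
    have := hJ.kernelCos_nonneg h1
    linarith [hcos ξ h1]
  have hρ : |1 - c * ξ ^ 2| = 1 - c * ξ ^ 2 := abs_of_nonneg (by linarith)
  have h := integral_exp_mul_le hJ hH hT hU ht
    (G := fejerIter J N ξ) (B := fun n _ => (N : ℝ)⁻¹ + (1 - c * ξ ^ 2) ^ n)
    (S := fun _ => (N : ℝ)⁻¹ + Real.exp (-(t * (c * ξ ^ 2))))
    (continuous_fejerIter J N ξ) (hJ.fejerIter_nonneg N ξ)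
    (fun n x => (hJ.kernelAvg_fejerIter N ξ n x).le) (fun n => measurable_const)
    (fun n x => by
      have := hJ.fejerIter_le hc hcos hN hξ hξd n x
      rwa [hρ] at this)
    (fun x => by
      have h1 := (hasSum_poissonWeight t).mul_right (N : ℝ)⁻¹
      have h2 := hasSum_poissonWeight_mul_pow t (1 - c * ξ ^ 2)
      have h3 := h1.add h2
      rw [one_mul, sub_sub_cancel] at h3
      simpa only [mul_add] using h3) (hUi.mul_const _)
  rw [integral_mul_const] at h
  set v := NormedSpace.exp (t • (T - 1)) U
  have hvi := L1.integrable_coeFn v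
  rw [← integral_indicator Metric.isOpen_ball.measurableSet]
  have h2 : ∫ x, (Metric.ball (0 : Plane) r).indicator v x ≤
      ∫ x, 2 * (v x * fejerIter J N ξ 0 x) := by
    apply integral_mono_ae (hvi.indicator Metric.isOpen_ball.measurableSet) (h.1.const_mul 2)
    filter_upwards [hv] with x hx
    by_cases hxr : x ∈ Metric.ball (0 : Plane) r
    · rw [Set.indicator_of_mem hxr]
      have hxr' : ‖x‖ ≤ r := by
        rw [Metric.mem_ball, dist_zero_right] at hxr
        exact hxr.le
      have h3 := half_le_fejerIter_zero J hN hξ (x := x) (le_trans (by gcongr) hξr)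
      have := mul_le_mul_of_nonneg_left h3 hx
      linarith
    · rw [Set.indicator_of_notMem hxr]
      have := hJ.fejerIter_nonneg N ξ 0 x
      positivity
  rw [integral_const_mul] at h2
  refine h2.trans ?_
  rw [mul_comm _ (∫ x, U x)]
  exact mul_le_mul_of_nonneg_left h.2 (by norm_num)

end Moments

/-! ### Comparing the mass with the conserved moment. -/

section MassBounds

variable {H : Set Plane} {φ : Plane → ℝ} {v : Plane → ℝ} {C : ℝ}

/-- A Markov-type inequality: `φ ≥ log r - C` outside the ball and the hole, and `φ ≥ 0` inside the
ball. -/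
lemma log_sub_mul_mass_le (hφ0 : ∀ᵐ x, 0 ≤ φ x)
    (hC : ∀ᵐ x, x ∉ H → |φ x - Real.log ‖x‖| ≤ C) (hv : Integrable v) (hv0 : ∀ᵐ x, 0 ≤ v x)
    (hvH : ∀ᵐ x, x ∈ H → v x = 0) (hvφ : Integrable fun x => v x * φ x) {r : ℝ} (hr : 0 < r) :
    (Real.log r - C) * ((∫ x, v x) - ∫ x in Metric.ball (0 : Plane) r, v x) ≤
      ∫ x, v x * φ x := by
  have hm := measurableSet_ball (x := (0 : Plane)) (ε := r)
  rw [← integral_add_compl hm hv, add_sub_cancel_left, ← integral_indicator hm.compl,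
    ← integral_const_mul]
  apply integral_mono_ae ((hv.indicator hm.compl).const_mul _) hvφ
  filter_upwards [hφ0, hC, hv0, hvH] with x h1 h2 h3 h4
  by_cases hx : x ∈ (Metric.ball (0 : Plane) r)ᶜ
  · rw [Set.indicator_of_mem hx]
    by_cases hxH : x ∈ H
    · simp [h4 hxH]
    · have h5 := (abs_le.1 (h2 hxH)).1
      have h6 : r ≤ ‖x‖ := by simpa using hx
      have h7 := Real.log_le_log hr h6
      rw [mul_comm]
      exact mul_le_mul_of_nonneg_left (by linarith) h3
  · rw [Set.indicator_of_notMem hx, mul_zero]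
    exact mul_nonneg h3 h1

/-- Apply `log y ≤ y - 1` to `y = ‖x‖² / s`: the logarithm is replaced by a constant plus a multiple
of the second moment. -/
lemma integral_mul_le_log_add_mul_mass (hH : IsHole H)
    (hC : ∀ᵐ x, x ∉ H → |φ x - Real.log ‖x‖| ≤ C) (hv : Integrable v) (hv0 : ∀ᵐ x, 0 ≤ v x)
    (hvH : ∀ᵐ x, x ∈ H → v x = 0) (hvφ : Integrable fun x => v x * φ x)
    (hv2 : Integrable fun x => v x * ‖x‖ ^ 2) {s : ℝ} (hs : 0 < s) :
    ∫ x, v x * φ x ≤ (Real.log s / 2 + C) * (∫ x, v x) + (∫ x, v x * ‖x‖ ^ 2) / s := by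
  have hle : ∫ x, v x * φ x ≤ ∫ x, ((Real.log s / 2 + C) * v x + (v x * ‖x‖ ^ 2) / s) := by
    apply integral_mono_ae hvφ ((hv.const_mul _).add (hv2.div_const _))
    filter_upwards [hC, hv0, hvH] with x h2 h3 h4
    by_cases hxH : x ∈ H
    · simp [h4 hxH]
    · have h5 := (abs_le.1 (h2 hxH)).2
      have hx2 := hH.two_le_norm hxH
      have h6 : Real.log (‖x‖ ^ 2 / s) ≤ ‖x‖ ^ 2 / s - 1 :=
        Real.log_le_sub_one_of_pos (by positivity)
      rw [Real.log_div (by positivity) hs.ne', Real.log_pow] at h6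
      have h7 : 0 ≤ ‖x‖ ^ 2 / s := by positivity
      push_cast at h6
      have h8 : φ x ≤ Real.log s / 2 + C + ‖x‖ ^ 2 / s := by linarith
      refine (mul_le_mul_of_nonneg_left h8 h3).trans (le_of_eq ?_)
      change _ = (Real.log s / 2 + C) * v x + (v x * ‖x‖ ^ 2) / s
      ring
  rw [integral_add (hv.const_mul _) (hv2.div_const _), integral_const_mul, integral_div] at hle
  exact hle

end MassBounds

/-! ### Asymptotics in the variable `L = log t`. -/

lemma tendsto_self_div_affine_log (a b : ℝ) :
    Tendsto (fun L : ℝ => L / (L / 2 + a * Real.log L + b)) atTop (𝓝 2) := by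
  have h1 : Tendsto (fun L : ℝ => Real.log L / L) atTop (𝓝 0) :=
    Real.isLittleO_log_id_atTop.tendsto_div_nhds_zero
  have h2 : Tendsto (fun L : ℝ => L⁻¹) atTop (𝓝 0) := tendsto_inv_atTop_zero
  have h3 : Tendsto (fun L : ℝ => (1 / 2 + a * (Real.log L / L) + b * L⁻¹)⁻¹) atTop
      (𝓝 (1 / 2 + a * 0 + b * 0)⁻¹) :=
    ((tendsto_const_nhds.add (h1.const_mul a)).add (h2.const_mul b)).inv₀ (by norm_num)
  have e : (1 / 2 + a * 0 + b * 0 : ℝ)⁻¹ = 2 := by norm_num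
  rw [e] at h3
  refine h3.congr' ?_
  filter_upwards [eventually_gt_atTop 0] with L hL
  rw [inv_eq_one_div, ← mul_div_mul_left 1 _ hL.ne']
  congr 1
  · ring
  · field_simp

section Asymptotics

lemma eventually_log_pow_le_sqrt (a : ℝ) :
    ∀ᶠ t : ℝ in atTop, a * Real.log t ^ 3 ≤ Real.sqrt t := by
  have h := (Real.isLittleO_pow_log_id_atTop (n := 6)).bound
    (show 0 < (a ^ 2 + 1)⁻¹ by positivity)
  filter_upwards [h, eventually_ge_atTop 0] with t ht ht0
  apply Real.le_sqrt_of_sq_le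
  rw [Real.norm_eq_abs, Real.norm_eq_abs, id, abs_of_nonneg (by positivity), abs_of_nonneg ht0,
    inv_mul_eq_div, le_div_iff₀ (by positivity)] at ht
  have : 0 ≤ Real.log t ^ 6 := by positivity
  nlinarith

/-- If the mass `m` satisfies the two-sided bounds that come from the conservation of
`∫ u φ = M`, then `log t * m t → 2 M`. -/
lemma tendsto_log_mul_of_bounds {m : ℝ → ℝ} {M C A B K : ℝ}
    (hupper : ∀ᶠ t : ℝ in atTop, (Real.log t / 2 + (-3) * Real.log (Real.log t) + C) *
      (m t - K / Real.log t ^ 2) ≤ M)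
    (hlower : ∀ᶠ t : ℝ in atTop, M ≤ (Real.log t / 2 + (1 / 2) * Real.log (Real.log t) + B) * m t +
      A / Real.log t) :
    Tendsto (fun t => Real.log t * m t) atTop (𝓝 (2 * M)) := by
  have hinv : Tendsto (fun L : ℝ => L⁻¹) atTop (𝓝 0) := tendsto_inv_atTop_zero
  have hlow : Tendsto (fun L : ℝ => L / (L / 2 + (1 / 2) * Real.log L + B) * (M - A * L⁻¹))
      atTop (𝓝 (2 * M)) := by
    have := (tendsto_self_div_affine_log (1 / 2) B).mul
      ((tendsto_const_nhds (x := M)).sub (hinv.const_mul A))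
    simpa using this
  have hup : Tendsto (fun L : ℝ => L / (L / 2 + (-3) * Real.log L + C) * M + K * L⁻¹)
      atTop (𝓝 (2 * M)) := by
    have := ((tendsto_self_div_affine_log (-3) C).mul_const M).add (hinv.const_mul K)
    simpa using this
  -- A quotient with positive numerator that tends to `2` has an eventually positive denominator.
  have hpos : ∀ a b : ℝ, ∀ᶠ L : ℝ in atTop, 0 < L / 2 + a * Real.log L + b := by
    intro a b
    filter_upwards [(tendsto_self_div_affine_log a b).eventually (lt_mem_nhds one_lt_two),
      eventually_gt_atTop 0] with L hL hL0
    by_contra! h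
    have := div_nonpos_of_nonneg_of_nonpos hL0.le h
    linarith
  refine tendsto_of_tendsto_of_tendsto_of_le_of_le' (hlow.comp Real.tendsto_log_atTop)
    (hup.comp Real.tendsto_log_atTop) ?_ ?_
  · filter_upwards [hlower, Real.tendsto_log_atTop.eventually (hpos (1 / 2) B),
      Real.tendsto_log_atTop.eventually (eventually_gt_atTop 0)] with t h1 h2 h3
    simp only [Function.comp_apply]
    rw [div_mul_eq_mul_div, div_le_iff₀ h2, mul_assoc]
    refine mul_le_mul_of_nonneg_left ?_ h3.le
    rw [← div_eq_mul_inv]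
    linarith
  · filter_upwards [hupper, Real.tendsto_log_atTop.eventually (hpos (-3) C),
      Real.tendsto_log_atTop.eventually (eventually_gt_atTop 0)] with t h1 h2 h3
    simp only [Function.comp_apply]
    have h4 : m t - K / Real.log t ^ 2 ≤ M / (Real.log t / 2 + (-3) * Real.log (Real.log t) + C) := by
      rw [le_div_iff₀ h2]
      linarith
    have h5 := mul_le_mul_of_nonneg_left h4 h3.le
    have e : Real.log t * (m t - K / Real.log t ^ 2) = Real.log t * m t - K * (Real.log t)⁻¹ := by
      field_simp
    rw [e] at h5
    have e2 : Real.log t * (M / (Real.log t / 2 + (-3) * Real.log (Real.log t) + C)) =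
        Real.log t / (Real.log t / 2 + (-3) * Real.log (Real.log t) + C) * M := by ring
    linarith

variable {d : ℝ} {J : Plane → ℝ} {H : Set Plane}
  {T : Lp ℝ 1 (volume : Measure Plane) →L[ℝ] Lp ℝ 1 (volume : Measure Plane)}
  {U : Lp ℝ 1 (volume : Measure Plane)}

/-- With `L = log t`, take `N = ⌈L²⌉` and `ξ = L / √t`. Then `1 / N ≤ L⁻²`, and `t ξ² = L²` makes
the exponential at most `1 / (c L²)`. Since `N ξ ≤ 2 L³ / √t`, the radius `√t / (2 L³)` is
admissible, and `N ξ d ≤ 1` for large `t`. -/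
lemma exists_setIntegral_ball_le (hJ : IsDispersalKernel d J) (hH : IsOpen H)
    (hT : ∀ f, T f =ᵐ[volume] killedAvg J H f) (hU : ∀ᵐ x, 0 ≤ U x) :
    ∃ K : ℝ, ∀ᶠ t : ℝ in atTop,
      ∫ x in Metric.ball (0 : Plane) (Real.sqrt t / (2 * Real.log t ^ 3)),
        NormedSpace.exp (t • (T - 1)) U x ≤ K / Real.log t ^ 2 := by
  obtain ⟨c, hc, hcos⟩ := hJ.exists_kernelCos_le
  have hm0 : 0 ≤ ∫ x, U x := integral_nonneg_of_ae hU
  refine ⟨2 * ((1 + c⁻¹) * ∫ x, U x), ?_⟩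
  filter_upwards [eventually_log_pow_le_sqrt (2 * d), eventually_gt_atTop 0,
    Real.tendsto_log_atTop.eventually (eventually_ge_atTop 1)] with t h1 ht hL
  set L := Real.log t with hLdef
  have hL0 : 0 < L := by linarith
  have hst : 0 < Real.sqrt t := Real.sqrt_pos.2 ht
  have hceil := Nat.le_ceil (L ^ 2)
  have hN : 0 < ⌈L ^ 2⌉₊ := Nat.ceil_pos.2 (by positivity)
  have hN2 : (⌈L ^ 2⌉₊ : ℝ) ≤ 2 * L ^ 2 := by
    have := (Nat.ceil_lt_add_one (show 0 ≤ L ^ 2 by positivity)).le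
    nlinarith
  have hNξ : (⌈L ^ 2⌉₊ : ℝ) * (L / Real.sqrt t) ≤ 2 * L ^ 3 / Real.sqrt t := by
    refine (mul_le_mul_of_nonneg_right hN2 (by positivity)).trans (le_of_eq ?_)
    ring
  have hd := hJ.d_pos
  have hmain := setIntegral_ball_exp_le hJ hH hT hU hc hcos hN
    (ξ := L / Real.sqrt t) (r := Real.sqrt t / (2 * L ^ 3)) (by positivity)
    (by
      refine (mul_le_mul_of_nonneg_right hNξ hd.le).trans ?_
      rw [div_mul_eq_mul_div, div_le_one hst]
      linarith)
    (by
      refine (mul_le_mul_of_nonneg_right hNξ (by positivity)).trans (le_of_eq ?_)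
      field_simp) ht.le
  refine hmain.trans ?_
  have e : t * (c * (L / Real.sqrt t) ^ 2) = c * L ^ 2 := by
    rw [div_pow, Real.sq_sqrt ht.le]
    field_simp
  have h2 : Real.exp (-(c * L ^ 2)) ≤ (c * L ^ 2)⁻¹ := by
    rw [Real.exp_neg]
    apply inv_anti₀ (by positivity)
    linarith [Real.add_one_le_exp (c * L ^ 2)]
  have h3 : ((⌈L ^ 2⌉₊ : ℝ))⁻¹ ≤ (L ^ 2)⁻¹ := inv_anti₀ (by positivity) hceil
  rw [e]
  calc 2 * (((⌈L ^ 2⌉₊ : ℝ)⁻¹ + Real.exp (-(c * L ^ 2))) * ∫ x, U x)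
      ≤ 2 * (((L ^ 2)⁻¹ + (c * L ^ 2)⁻¹) * ∫ x, U x) := by gcongr
    _ = _ := by rw [mul_inv]; ring

lemma tendsto_log_mul_integral (hJ : IsDispersalKernel d J) (hH : IsHole H) {φ : Plane → ℝ}
    (hφ : IsLogStationary J H φ) {v : ℝ → Plane → ℝ} {M A B K : ℝ} (hA : 0 ≤ A)
    (hvi : ∀ t, 0 < t → Integrable (v t)) (hv0 : ∀ t, 0 < t → ∀ᵐ x, 0 ≤ v t x)
    (hvH : ∀ t, 0 < t → ∀ᵐ x, x ∈ H → v t x = 0)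
    (hvφ : ∀ t, 0 < t → Integrable (fun x => v t x * φ x) ∧ ∫ x, v t x * φ x = M)
    (hv2 : ∀ t, 0 < t → Integrable (fun x => v t x * ‖x‖ ^ 2) ∧
      ∫ x, v t x * ‖x‖ ^ 2 ≤ A + B * t)
    (hK : ∀ᶠ t : ℝ in atTop, ∫ x in Metric.ball (0 : Plane) (Real.sqrt t / (2 * Real.log t ^ 3)),
      v t x ≤ K / Real.log t ^ 2) :
    Tendsto (fun t : ℝ => Real.log t * ∫ x, v t x) atTop (𝓝 (2 * M)) := by
  obtain ⟨C, hC0, hC⟩ := hφ.exists_bound hH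
  have hφ0 := hφ.ae_nonneg hJ hH
  -- The lower bound for the mass outside the ball may be multiplied by this factor only once the
  -- factor is nonnegative.
  have hpos : ∀ᶠ t : ℝ in atTop,
      0 ≤ Real.log t / 2 + (-3) * Real.log (Real.log t) + (-Real.log 2 - C) := by
    have h := (tendsto_self_div_affine_log (-3) (-Real.log 2 - C)).eventually
      (lt_mem_nhds one_lt_two)
    filter_upwards [Real.tendsto_log_atTop.eventually h,
      Real.tendsto_log_atTop.eventually (eventually_gt_atTop 0)] with t ht ht0
    by_contra! h
    have := div_nonpos_of_nonneg_of_nonpos ht0.le h.le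
    linarith
  refine tendsto_log_mul_of_bounds (C := -Real.log 2 - C) (A := A + B) (B := C) (K := K) ?_ ?_
  · filter_upwards [hK, hpos, eventually_gt_atTop 0,
      Real.tendsto_log_atTop.eventually (eventually_gt_atTop 0)] with t h1 h2 ht hL
    have hst : 0 < Real.sqrt t := Real.sqrt_pos.2 ht
    have hmain := log_sub_mul_mass_le hφ0 hC (hvi t ht) (hv0 t ht) (hvH t ht) (hvφ t ht).1
      (r := Real.sqrt t / (2 * Real.log t ^ 3)) (by positivity)
    rw [(hvφ t ht).2, Real.log_div hst.ne' (by positivity), Real.log_sqrt ht.le,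
      Real.log_mul two_ne_zero (by positivity), Real.log_pow] at hmain
    refine le_trans ?_ hmain
    have e : Real.log t / 2 - (Real.log 2 + (3 : ℕ) * Real.log (Real.log t)) - C =
        Real.log t / 2 + (-3) * Real.log (Real.log t) + (-Real.log 2 - C) := by
      push_cast
      ring
    rw [e]
    exact mul_le_mul_of_nonneg_left (by linarith) h2
  · filter_upwards [eventually_ge_atTop 1,
      Real.tendsto_log_atTop.eventually (eventually_gt_atTop 0)] with t ht hL
    have ht0 : 0 < t := by linarith
    obtain ⟨h2i, h2⟩ := hv2 t ht0
    -- The choice `s = t log t` costs only `(log log t) / 2` in the main term and reduces the moment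
    -- term to `(A + B) / log t`.
    have hmain := integral_mul_le_log_add_mul_mass hH hC (hvi t ht0) (hv0 t ht0) (hvH t ht0)
      (hvφ t ht0).1 h2i (s := t * Real.log t) (by positivity)
    rw [(hvφ t ht0).2, Real.log_mul ht0.ne' hL.ne'] at hmain
    refine hmain.trans ?_
    apply add_le_add (le_of_eq (by ring))
    rw [div_le_div_iff₀ (by positivity) hL]
    have h3 : (∫ x, v t x * ‖x‖ ^ 2) ≤ (A + B) * t := by
      refine h2.trans ?_
      nlinarith
    calc _ ≤ ((A + B) * t) * Real.log t := mul_le_mul_of_nonneg_right h3 hL.le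
      _ = _ := by ring

/-- The mass of the solution of the Dirichlet problem decays like `2 M / log t`. -/
lemma tendsto_log_mul_mass (hJ : IsDispersalKernel d J) (hH : IsHole H) {φ : Plane → ℝ}
    (hφ : IsLogStationary J H φ) (hT : ∀ f, T f =ᵐ[volume] killedAvg J H f)
    (hU : ∀ᵐ x, 0 ≤ U x) (hUH : ∀ᵐ x, x ∈ H → U x = 0) (hUφ : Integrable fun x => U x * φ x)
    (hU2 : Integrable fun x => U x * ‖x‖ ^ 2) :
    Tendsto (fun t : ℝ => Real.log t * ∫ x, NormedSpace.exp (t • (T - 1)) U x) atTop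
      (𝓝 (2 * ∫ x, U x * φ x)) := by
  obtain ⟨K, hK⟩ := exists_setIntegral_ball_le hJ hH.isOpen hT hU
  exact tendsto_log_mul_integral hJ hH hφ
    (integral_nonneg_of_ae (hU.mono fun x hx => mul_nonneg hx (sq_nonneg _)))
    (fun t _ => L1.integrable_coeFn _) (fun t ht => ae_nonneg_exp hJ hT hU ht.le)
    (isDirichletSolution_exp hT (Filter.EventuallyEq.refl _ (U : Plane → ℝ)) hUH).dirichlet
    (fun t ht => integral_exp_mul_stationary hJ hH hφ hT hU hUH hUφ ht.le)
    (fun t ht => integral_exp_mul_normSq_le hJ hH.isOpen hT hU hU2 ht.le) hK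

end Asymptotics

/-! ### Integrability of the datum and the theorem. -/

namespace IsAdmissibleDatum

variable {H : Set Plane} {u₀ : Plane → ℝ}

/-- The datum lives where `‖x‖ ≥ 2`, so the weight `‖x‖²` dominates `1`. -/
lemma integrable (hu : IsAdmissibleDatum H u₀) (hH : IsHole H) : Integrable u₀ := by
  refine hu.second_moment.mono hu.bounded.1 ?_
  filter_upwards [hu.eq_zero] with x hx
  by_cases hxH : x ∈ H
  · simp [hx hxH]
  · have := hH.two_le_norm hxH
    rw [norm_mul]
    apply le_mul_of_one_le_right (norm_nonneg _)
    rw [norm_pow, norm_norm]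
    nlinarith

lemma integrable_mul {J φ : Plane → ℝ} (hu : IsAdmissibleDatum H u₀) (hH : IsHole H)
    (hφ : IsLogStationary J H φ) : Integrable fun x => u₀ x * φ x := by
  obtain ⟨C, -, hC⟩ := hφ.exists_bound hH
  have hb := hu.log_moment.add ((hu.integrable hH).mul_const C)
  refine hb.mono' (hu.bounded.1.mul (hφ.aestronglyMeasurable hH)) ?_
  filter_upwards [hu.eq_zero, hu.nonneg, hC] with x h1 h2 h3
  by_cases hxH : x ∈ H
  · simp [h1 hxH]
  · have h4 := abs_le.1 (h3 hxH)
    have h5 := hH.log_norm_nonneg hxH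
    rw [norm_mul, Real.norm_of_nonneg h2, Pi.add_apply, ← mul_add]
    apply mul_le_mul_of_nonneg_left _ h2
    rw [Real.norm_eq_abs, abs_le]
    constructor <;> linarith [h4.1, h4.2]

end IsAdmissibleDatum

theorem mainTheorem7 (H : Set Plane) (hH : IsHole H)
    (d : ℝ) (J : Plane → ℝ) (hJ : IsDispersalKernel d J)
    (u₀ : Plane → ℝ) (hu₀ : IsAdmissibleDatum H u₀) :
    (∃! φ : Plane → ℝ, IsLogStationary J H φ) ∧
    (∃ u : ℝ → Lp ℝ 1 (volume : Measure Plane), IsDirichletSolution J H u₀ u ∧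
      ∀ v : ℝ → Lp ℝ 1 (volume : Measure Plane), IsDirichletSolution J H u₀ v →
        Set.EqOn v u (Set.Ici 0)) ∧
    ∀ (φ : Plane → ℝ) (u : ℝ → Lp ℝ 1 (volume : Measure Plane)),
      IsLogStationary J H φ → IsDirichletSolution J H u₀ u →
        Integrable (fun x => u₀ x * φ x) volume ∧
        Tendsto (fun t : ℝ => Real.log t * ∫ x, u t x) atTop
          (𝓝 (2 * ∫ x, u₀ x * φ x)) := by
  obtain ⟨T, hT⟩ := hJ.exists_killedConv hH.isOpen
  obtain ⟨U, hU0⟩ : ∃ U : Lp ℝ 1 (volume : Measure Plane), U =ᵐ[volume] u₀ :=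
    ⟨(hu₀.integrable hH).toL1 u₀, Integrable.coeFn_toL1 _⟩
  have hU : ∀ᵐ x, 0 ≤ U x := by
    filter_upwards [hU0, hu₀.nonneg] with x h1 h2
    rwa [h1]
  have hUH : ∀ᵐ x, x ∈ H → U x = 0 := by
    filter_upwards [hU0, hu₀.eq_zero] with x h1 h2
    rwa [h1]
  have huniq : ∀ v : ℝ → Lp ℝ 1 (volume : Measure Plane), IsDirichletSolution J H u₀ v →
      Set.EqOn v (fun t => NormedSpace.exp (t • (T - 1)) U) (Set.Ici 0) := by
    intro v hv t ht
    have h0 : v 0 = U := by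
      apply Lp.ext
      filter_upwards [hv.initial, hU0] with x h1 h2
      rw [h1, h2]
    have := eq_exp_smul_of_hasDerivAt (T - 1) hv.continuousOn
      (fun s hs => hv.hasDerivAt hH.isOpen hT hs) ht
    rwa [h0] at this
  refine ⟨?_, ⟨_, isDirichletSolution_exp hT hU0 hUH, huniq⟩, fun φ u hφ hu => ?_⟩
  · obtain ⟨φ, hφ⟩ := hJ.exists_isLogStationary hH
    exact ⟨φ, hφ, fun ψ hψ => hψ.eq_of_isLogStationary hφ hJ hH⟩
  · have hint := hu₀.integrable_mul hH hφ
    refine ⟨hint, ?_⟩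
    have e : (fun x => U x * φ x) =ᵐ[volume] fun x => u₀ x * φ x := by
      filter_upwards [hU0] with x hx
      rw [hx]
    have e2 : (fun x => U x * ‖x‖ ^ 2) =ᵐ[volume] fun x => u₀ x * ‖x‖ ^ 2 := by
      filter_upwards [hU0] with x hx
      rw [hx]
    have h := tendsto_log_mul_mass hJ hH hφ hT hU hUH (hint.congr e.symm)
      (hu₀.second_moment.congr e2.symm)
    rw [integral_congr_ae e] at h
    refine h.congr' ?_
    filter_upwards [eventually_ge_atTop 0] with t ht
    rw [huniq u hu ht]
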